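/- Let $G$ be a finitely presented group. For a finitely presented group $\Gamma$ let $d(\Gamma)$ be the minimal number of generators of $\Gamma$, and let $\rho(\Gamma)$ be the minimal number of relators in any finite presentation of $\Gamma$. Write $H_iG=H_i(G,\mathbb Z)$, and let $G^n$ be the direct product of $n$ copies of $G$. The symbols $O$ and $\Theta$ refer to $n\to\infty$, with implied constants that may depend on $G$. 1. If $H_1G\neq 0$, then $d(G^n)=\Theta(n)$ and $\rho(G^n)=\Theta(n^2)$. 2. If $H_1G=0$ and $H_2G\neq 0$, then $d(G^n)=O(\log n)$ and $\rho(G^n)=\Theta(n)$. 3. If $H_1G=H_2G=0$, then $d(G^n)=O(\log n)$ and $\rho(G^n)=O((\log n)^3)$. 4. If $H_1G=H_2G=0$ and $G$ has a non-trivial finite quotient, then $d(G^n)=\Theta(\log n)$ and there are constants $c_0,c_1>0$ such that $c_0\log n\le\rho(G^n)\le c_1(\log n)^3$ for all $n\ge 2$. 5. If $H_1G=H_2G=0$ and there is an element $g\in G$ whose image has infinite order in every non-trivial quotient of $G$, then $d(G^n)\le d(G)+1$ for all $n$, and $\rho(G^n)=O(\log n)$. In each case the upper bounds on $d(G^n)$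 and $\rho(G^n)$ can be satisfied simultaneously: there is a constant $C$ (depending on $G$) such that for every $n\ge 2$ the group $G^n$ has a single presentation with at most $k$ generators and at most $r$ relators, where $(k,r)$ is $(Cn,\,Cn^2)$ in case 1, $(C\log n,\,Cn)$ in case 2, $(C\log n,\,C(\log n)^3)$ in cases 3 and 4, and $(d(G)+1,\,C\log n)$ in case 5. -/

import Mathlib

open Filter Asymptotics

universe u

/-- A finitely presented group is finitely generated. -/
instance Group.IsFinitelyPresented.instFG (G : Type u) [Group G] [h : Group.IsFinitelyPresented G] :
    Group.FG G := by
  obtain ⟨n, φ, hφ, -⟩ := h.out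
  exact Group.fg_of_surjective hφ

/-- The integral homology group `H_i(G, ℤ)` (with trivial coefficients). The ring `ℤ` is lifted to
the universe of `G` because Mathlib's group homology takes both in the same universe. -/
noncomputable abbrev integralHomology (G : Type u) [Group G] (i : ℕ) : ModuleCat.{u} (ULift.{u} ℤ) :=
  groupHomology (Rep.trivial (ULift.{u} ℤ) G (ULift.{u} ℤ)) i

/-- `HasPresentation Γ k r`: the group `Γ` has a presentation with exactly `k` generators and
exactly `r` relators. -/
def HasPresentation (Γ : Type u) [Group Γ] (k r : ℕ) : Prop :=
  ∃ R : Finset (FreeGroup (Fin k)),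
    R.card = r ∧ Nonempty (PresentedGroup (R : Set (FreeGroup (Fin k))) ≃* Γ)

/-- `ρ(Γ)`: the minimum number of relators in any finite presentation of `Γ`.
It is only meaningful when `Γ` is finitely presented. -/
noncomputable def minRelators (Γ : Type u) [Group Γ] : ℕ :=
  sInf {r | ∃ k, HasPresentation Γ k r}

/-! Upper bounds. If `G` is not perfect, the obvious presentations of `G ^ n` suffice: relators of
each factor, and commutators between factors. If `G` is perfect, commutators of elements that vanish
on different coordinates show that a subgroup of `G ^ n` is everything once it separates pairs of
coordinates (`Subgroup.eq_top_of_separates`). So diagonal copies of `G` indexed by binary digits of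
the coordinate generate, and, given an element `g` of infinite order in all nontrivial quotients, so
do the diagonal and the single tuple of powers of `g`.

Relators are saved by doubling (`PresentedBy.prod_self`). For perfect `Γ`, impose the relators of
`Γ` only on the diagonal of `Γ × Γ`, let the two factors commute, and write each generator as a
product of commutators. The result is a perfect central extension of `Γ × Γ`, whose kernel is
controlled by the Schur multiplier and is trivial in the superperfect case. A Tietze move then
returns to a generating family of fixed size `K`. About `log n` doublings at a cost of `O(K ^ 2)`
each give `O((log n) ^ 3)` for `K = O(log n)` and `O(log n)` for bounded `K`; a nontrivial
multiplier adds a term linear in `n`. General `n` follows because `G ^ n` is a retract of `G ^ (2 ^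
M)`.

Lower bounds. A cocycle with values in a field splits over the free group of a presentation, and
only its values on the relators obstruct descent of the splitting. So the relators are at least as
many as the cocycles independent modulo coboundaries (`PresentedBy.card_le_of_independent`).
Products of characters of different coordinates give quadratically many such cocycles if `H₁ ≠ 0`;
pulling back one nontrivial class along the projections gives `n` of them if `H₁ = 0` and `H₂ ≠ 0`.
With a finite quotient, counting maps from generators to it bounds the rank below, and a perfect
group needs at least as many relators as generators. -/

open scoped commutatorElement

/-! ### Free groups, generating families and presentations with indexed relators -/

open Function in
/-- A homomorphism from a free group lifts along a surjection. -/
theorem FreeGroup.exists_comp_eq {α A Γ : Type*} [Group A] [Group Γ] {φ : A →* Γ}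
    (hφ : Surjective φ) (f : FreeGroup α →* Γ) : ∃ w : FreeGroup α →* A, ∀ x, φ (w x) = f x := by
  choose s hs using hφ
  refine ⟨FreeGroup.lift fun a => s (f (.of a)), fun x => ?_⟩
  have : φ.comp (FreeGroup.lift fun a => s (f (.of a))) = f := by
    ext a; simp [hs]
  exact DFunLike.congr_fun this x

/-- Two homomorphisms out of free groups commute if they do so on generators. -/
theorem FreeGroup.commute_of_commute_of {α β Q : Type*} [Group Q] (f : FreeGroup α →* Q)
    (g : FreeGroup β →* Q) (h : ∀ a b, Commute (f (.of a)) (g (.of b))) (x : FreeGroup α)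
    (y : FreeGroup β) : Commute (f x) (g y) := by
  have h1 : ∀ a, Commute (f (.of a)) (g y) := fun a => by
    induction y using FreeGroup.induction_on with
    | C1 => simp
    | of b => exact h a b
    | inv_of b hb => rw [_root_.map_inv]; exact hb.inv_right
    | mul x y hx hy => rw [_root_.map_mul]; exact hx.mul_right hy
  induction x using FreeGroup.induction_on with
  | C1 => simp
  | of a => exact h1 a
  | inv_of b hb => rw [_root_.map_inv]; exact hb.inv_left
  | mul x y hx hy => rw [_root_.map_mul]; exact hx.mul_left hy

/-- `Γ` is generated by a family indexed by `α`. -/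
def GeneratedBy (α : Type) (Γ : Type*) [Group Γ] : Prop :=
  ∃ φ : FreeGroup α →* Γ, Function.Surjective φ

/-- `Γ` has a presentation with generators indexed by `α` and relators indexed by `β`,
repetitions among the relators being allowed. -/
def PresentedBy (α β : Type) (Γ : Type*) [Group Γ] : Prop :=
  ∃ (φ : FreeGroup α →* Γ) (rel : β → FreeGroup α), Function.Surjective φ ∧
    Subgroup.normalClosure (Set.range rel) = φ.ker

theorem PresentedBy.generatedBy {α β : Type} {Γ : Type*} [Group Γ] (h : PresentedBy α β Γ) :
    GeneratedBy α Γ := by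
  obtain ⟨φ, -, hφ, -⟩ := h
  exact ⟨φ, hφ⟩

theorem GeneratedBy.of_closure {α : Type} {Γ : Type*} [Group Γ] (x : α → Γ)
    (hx : Subgroup.closure (Set.range x) = ⊤) : GeneratedBy α Γ := by
  refine ⟨FreeGroup.lift x, ?_⟩
  rw [← MonoidHom.range_eq_top, FreeGroup.range_lift_eq_closure, hx]

theorem GeneratedBy.exists_closure {α : Type} {Γ : Type*} [Group Γ] (h : GeneratedBy α Γ) :
    ∃ x : α → Γ, Subgroup.closure (Set.range x) = ⊤ := by
  obtain ⟨φ, hφ⟩ := h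
  refine ⟨fun a => φ (.of a), ?_⟩
  rw [← FreeGroup.range_lift_eq_closure, MonoidHom.range_eq_top]
  convert hφ
  ext a; simp

theorem GeneratedBy.comp_surjective {α α' : Type} {Γ : Type*} [Group Γ] (h : GeneratedBy α Γ)
    (e : α' → α) (he : Function.Surjective e) : GeneratedBy α' Γ := by
  obtain ⟨φ, hφ⟩ := h
  exact ⟨φ.comp (FreeGroup.map e), hφ.comp (FreeGroup.map_surjective he)⟩

theorem generatedBy_rank (Γ : Type*) [Group Γ] [Group.FG Γ] :
    GeneratedBy (Fin (Group.rank Γ)) Γ := by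
  obtain ⟨S, hS, hc⟩ := Group.rank_spec Γ
  refine .of_closure (fun i => (S.equivFin.symm (Fin.cast hS.symm i) : Γ)) ?_
  rw [← hc]
  congr 1
  ext x
  constructor
  · rintro ⟨i, rfl⟩; simp
  · intro hx
    exact ⟨Fin.cast hS (S.equivFin ⟨x, hx⟩), by simp⟩

theorem GeneratedBy.rank_le {k : ℕ} {Γ : Type*} [Group Γ] [Group.FG Γ]
    (h : GeneratedBy (Fin k) Γ) : Group.rank Γ ≤ k := by
  classical
  obtain ⟨x, hx⟩ := h.exists_closure
  refine (Group.rank_le (S := Finset.univ.image x) (by simpa using hx)).trans ?_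
  exact Finset.card_image_le.trans (by simp)

/-- Presentations are determined up to bijections of the index types and isomorphism. -/
theorem PresentedBy.congr {α α' β β' : Type} {Γ Γ' : Type*} [Group Γ] [Group Γ']
    (h : PresentedBy α β Γ) (eα : α ≃ α') (eβ : β ≃ β') (e : Γ ≃* Γ') :
    PresentedBy α' β' Γ' := by
  obtain ⟨φ, rel, hφ, hr⟩ := h
  let F := FreeGroup.freeGroupCongr eα
  refine ⟨e.toMonoidHom.comp (φ.comp F.symm.toMonoidHom), fun b => F (rel (eβ.symm b)),
    e.surjective.comp (hφ.comp F.symm.surjective), ?_⟩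
  have h1 : Set.range (fun b => F (rel (eβ.symm b))) = F.toMonoidHom '' Set.range rel := by
    ext x
    constructor
    · rintro ⟨b, rfl⟩; exact ⟨_, ⟨_, rfl⟩, rfl⟩
    · rintro ⟨_, ⟨b, rfl⟩, rfl⟩; exact ⟨eβ b, by simp⟩
  rw [h1, ← Subgroup.map_normalClosure _ F.toMonoidHom F.surjective, hr]
  ext x
  simp only [Subgroup.mem_map, MonoidHom.mem_ker, MonoidHom.comp_apply, MulEquiv.coe_toMonoidHom,
    EmbeddingLike.map_eq_one_iff]
  constructor
  · rintro ⟨y, hy, rfl⟩; simpa using hy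
  · intro hx; exact ⟨F.symm x, hx, by simp⟩

theorem PresentedBy.add_trivial {α β : Type} {Γ : Type*} [Group Γ] (γ : Type)
    (h : PresentedBy α β Γ) : PresentedBy α (β ⊕ γ) Γ := by
  obtain ⟨φ, rel, hφ, hr⟩ := h
  refine ⟨φ, Sum.elim rel fun _ => 1, hφ, hr ▸ le_antisymm ?_ ?_⟩
  · refine Subgroup.normalClosure_le_normal ?_
    rintro _ ⟨b | b, rfl⟩
    · exact Subgroup.subset_normalClosure ⟨b, rfl⟩
    · exact one_mem _
  · refine Subgroup.normalClosure_mono ?_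
    rintro _ ⟨b, rfl⟩
    exact ⟨.inl b, rfl⟩

/-- Padding with trivial relators turns an upper bound on their number into an exact count, so later
estimates need only inequalities. -/
theorem PresentedBy.of_card_le {α β : Type} {Γ : Type*} [Group Γ] [Finite α] [Finite β]
    (h : PresentedBy α β Γ) {k r : ℕ} (hk : Nat.card α = k) (hr : Nat.card β ≤ r) :
    PresentedBy (Fin k) (Fin r) Γ := by
  refine (h.add_trivial (Fin (r - Nat.card β))).congr (Finite.equivFinOfCardEq hk)
    (Finite.equivFinOfCardEq ?_) (MulEquiv.refl Γ)
  rw [Nat.card_sum, Nat.card_fin]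
  omega

theorem PresentedBy.hasPresentation {k r : ℕ} {Γ : Type u} [Group Γ]
    (h : PresentedBy (Fin k) (Fin r) Γ) : ∃ r' ≤ r, HasPresentation Γ k r' := by
  classical
  obtain ⟨φ, rel, hφ, hr⟩ := h
  refine ⟨(Finset.univ.image rel).card, Finset.card_image_le.trans (by simp),
    Finset.univ.image rel, rfl, ⟨?_⟩⟩
  refine (QuotientGroup.quotientMulEquivOfEq ?_).trans
    (QuotientGroup.quotientKerEquivOfSurjective φ hφ)
  rw [← hr]
  simp

theorem HasPresentation.presentedBy {k r : ℕ} {Γ : Type u} [Group Γ]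
    (h : HasPresentation Γ k r) : PresentedBy (Fin k) (Fin r) Γ := by
  obtain ⟨R, rfl, ⟨e⟩⟩ := h
  have h1 : PresentedBy (Fin k) R Γ := by
    refine ⟨e.toMonoidHom.comp (PresentedGroup.mk _), Subtype.val,
      e.surjective.comp (PresentedGroup.mk_surjective _), ?_⟩
    ext x
    simp only [MonoidHom.mem_ker, MonoidHom.comp_apply, MulEquiv.coe_toMonoidHom,
      EmbeddingLike.map_eq_one_iff, Subtype.range_coe_subtype]
    exact (QuotientGroup.eq_one_iff x).symm
  exact h1.congr (Equiv.refl _) R.equivFin (MulEquiv.refl _)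

theorem exists_presentedBy (G : Type u) [Group G] [h : Group.IsFinitelyPresented G] :
    ∃ k r : ℕ, PresentedBy (Fin k) (Fin r) G := by
  obtain ⟨k, φ, hφ, S, hS, hc⟩ := h.out
  have : Finite S := hS
  refine ⟨k, Nat.card S, PresentedBy.of_card_le (β := S) ⟨φ, Subtype.val, hφ, ?_⟩ (by simp) le_rfl⟩
  simpa using hc

theorem PresentedBy.minRelators_le {k r : ℕ} {Γ : Type u} [Group Γ]
    (h : PresentedBy (Fin k) (Fin r) Γ) : minRelators Γ ≤ r := by
  obtain ⟨r', h1, h2⟩ := h.hasPresentation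
  exact (Nat.sInf_le (show r' ∈ {r | ∃ k, HasPresentation Γ k r} from ⟨k, h2⟩)).trans h1

/-- The presentation `h` only serves to make the set of relator counts nonempty; the infimum of the
empty set would be the default value `0`. -/
theorem PresentedBy.le_minRelators {k r m : ℕ} {Γ : Type u} [Group Γ]
    (h : PresentedBy (Fin k) (Fin r) Γ)
    (hm : ∀ k' r', PresentedBy (Fin k') (Fin r') Γ → m ≤ r') : m ≤ minRelators Γ := by
  obtain ⟨r', -, h2⟩ := h.hasPresentation
  obtain ⟨k', hk'⟩ := Nat.sInf_mem (s := {r | ∃ k, HasPresentation Γ k r}) ⟨r', k, h2⟩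
  exact hm _ _ hk'.presentedBy

/-! ### Tietze moves, retracts and direct products of presentations -/

/-- If a substitution `u` fixes every generator modulo the normal subgroup `N`,
then it fixes every word modulo `N`. -/
theorem FreeGroup.mk_apply_eq_of_forall_of {α : Type*} {N : Subgroup (FreeGroup α)} [N.Normal]
    (u : FreeGroup α →* FreeGroup α) (h : ∀ a, .of a * (u (.of a))⁻¹ ∈ N) {x : FreeGroup α}
    (hx : u x ∈ N) : x ∈ N := by
  have h1 : (QuotientGroup.mk' N).comp u = QuotientGroup.mk' N := by
    ext a
    have := (QuotientGroup.eq_one_iff _).2 (h a)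
    simp only [QuotientGroup.mk_mul, QuotientGroup.mk_inv, mul_inv_eq_one] at this
    simpa using this.symm
  have h2 := DFunLike.congr_fun h1 x
  simp only [MonoidHom.comp_apply, QuotientGroup.mk'_apply] at h2
  rw [← QuotientGroup.eq_one_iff, ← h2, QuotientGroup.eq_one_iff]
  exact hx

/-- Rewrite the old relators in the new generators by `v`, and add one relator `y = v (w y)` for
each new generator. Modulo these, `v ∘ w` is the identity, and it sends a word trivial in `Γ` to a
consequence of the rewritten relators. The cost depends on the new family only. -/
theorem PresentedBy.change_generators {α β α' : Type} {Γ : Type*} [Group Γ]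
    (h : PresentedBy α β Γ) (h' : GeneratedBy α' Γ) : PresentedBy α' (β ⊕ α') Γ := by
  obtain ⟨φ, rel, hφ, hr⟩ := h
  obtain ⟨ψ, hψ⟩ := h'
  obtain ⟨v, hv⟩ := FreeGroup.exists_comp_eq hψ φ
  obtain ⟨w, hw⟩ := FreeGroup.exists_comp_eq hφ ψ
  refine ⟨ψ, Sum.elim (fun b => v (rel b)) fun y => .of y * (v (w (.of y)))⁻¹, hψ,
    le_antisymm ?_ ?_⟩
  · refine Subgroup.normalClosure_le_normal ?_
    rintro _ ⟨b | y, rfl⟩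
    · have : rel b ∈ φ.ker := hr ▸ Subgroup.subset_normalClosure ⟨b, rfl⟩
      simpa [hv] using this
    · simp [hv, hw]
  · intro z hz
    refine FreeGroup.mk_apply_eq_of_forall_of (v.comp w)
      (fun y => Subgroup.subset_normalClosure (Set.mem_range_self (Sum.inr y))) ?_
    have h1 : w z ∈ Subgroup.normalClosure (Set.range rel) := by
      rw [hr, MonoidHom.mem_ker, hw]; exact hz
    have h2 : Subgroup.normalClosure (Set.range rel) ≤ (Subgroup.normalClosure (Set.range
        (Sum.elim (fun b => v (rel b)) fun y => .of y * (v (w (.of y)))⁻¹))).comap v := by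
      refine Subgroup.normalClosure_le_normal ?_
      rintro _ ⟨b, rfl⟩
      exact Subgroup.subset_normalClosure ⟨.inl b, rfl⟩
    exact h2 h1

/-- It suffices to identify each generator with its image under the idempotent `ι ∘ π`: a word that
dies in `Δ` is then equal to its image, which is already trivial in `Γ`. -/
theorem PresentedBy.retract {α β : Type} {Γ Δ : Type*} [Group Γ] [Group Δ]
    (h : PresentedBy α β Γ) (ι : Δ →* Γ) (π : Γ →* Δ) (hπ : ∀ x, π (ι x) = x) :
    PresentedBy α (β ⊕ α) Δ := by
  obtain ⟨φ, rel, hφ, hr⟩ := h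
  obtain ⟨w, hw⟩ := FreeGroup.exists_comp_eq hφ (ι.comp (π.comp φ))
  have hs : Function.Surjective π := fun x => ⟨ι x, hπ x⟩
  refine ⟨π.comp φ, Sum.elim rel fun y => .of y * (w (.of y))⁻¹, hs.comp hφ,
    le_antisymm ?_ ?_⟩
  · refine Subgroup.normalClosure_le_normal ?_
    rintro _ ⟨b | y, rfl⟩
    · have : rel b ∈ φ.ker := hr ▸ Subgroup.subset_normalClosure ⟨b, rfl⟩
      simp [MonoidHom.mem_ker.1 this]
    · simp [hw, hπ]
  · intro z hz
    refine FreeGroup.mk_apply_eq_of_forall_of w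
      (fun y => Subgroup.subset_normalClosure (Set.mem_range_self (Sum.inr y))) ?_
    have hz' : π (φ z) = 1 := hz
    have h1 : w z ∈ Subgroup.normalClosure (Set.range rel) := by
      rw [hr, MonoidHom.mem_ker, hw]; simp [hz']
    refine Subgroup.normalClosure_mono ?_ h1
    rintro _ ⟨b, rfl⟩
    exact ⟨.inl b, rfl⟩

/-- In a quotient of `FreeGroup (α ⊕ α')` in which the two families of generators commute, every
word is the product of its two projections. -/
theorem FreeGroup.mk_eq_mul_of_commute {α α' : Type*} {Q : Type*} [Group Q]
    (q : FreeGroup (α ⊕ α') →* Q)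
    (h : ∀ a b, Commute (q (.of (.inl a))) (q (.of (.inr b)))) (x : FreeGroup (α ⊕ α')) :
    q x = q (.map .inl (FreeGroup.lift (Sum.elim .of fun _ => 1) x)) *
      q (.map .inr (FreeGroup.lift (Sum.elim (fun _ => 1) .of) x)) := by
  have hc := FreeGroup.commute_of_commute_of (q.comp (FreeGroup.map Sum.inl))
    (q.comp (FreeGroup.map Sum.inr)) (by simpa using h)
  have h1 : q = (MonoidHom.noncommCoprod _ _ hc).comp
      ((FreeGroup.lift (Sum.elim .of fun _ => 1)).prod
        (FreeGroup.lift (Sum.elim (fun _ => 1) .of))) := by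
    ext (a | a) <;> simp
  exact DFunLike.congr_fun h1 x

theorem PresentedBy.prod {α β α' β' : Type} {Γ Δ : Type*} [Group Γ] [Group Δ]
    (h : PresentedBy α β Γ) (h' : PresentedBy α' β' Δ) :
    PresentedBy (α ⊕ α') ((β ⊕ β') ⊕ α × α') (Γ × Δ) := by
  obtain ⟨φ, rel, hφ, hr⟩ := h
  obtain ⟨ψ, rel', hψ, hr'⟩ := h'
  let p : FreeGroup (α ⊕ α') →* FreeGroup α := FreeGroup.lift (Sum.elim .of fun _ => 1)
  let q : FreeGroup (α ⊕ α') →* FreeGroup α' := FreeGroup.lift (Sum.elim (fun _ => 1) .of)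
  have p0 : ∀ x, p (.map .inl x) = x := fun x => by
    have : p.comp (FreeGroup.map Sum.inl) = MonoidHom.id _ := by ext; simp [p]
    exact DFunLike.congr_fun this x
  have p1 : ∀ x, p (.map .inr x) = 1 := fun x => by
    have : p.comp (FreeGroup.map Sum.inr) = 1 := by ext; simp [p]
    exact DFunLike.congr_fun this x
  have q1 : ∀ x, q (.map .inr x) = x := fun x => by
    have : q.comp (FreeGroup.map Sum.inr) = MonoidHom.id _ := by ext; simp [q]
    exact DFunLike.congr_fun this x
  have q0 : ∀ x, q (.map .inl x) = 1 := fun x => by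
    have : q.comp (FreeGroup.map Sum.inl) = 1 := by ext; simp [q]
    exact DFunLike.congr_fun this x
  let R : (β ⊕ β') ⊕ α × α' → FreeGroup (α ⊕ α') :=
    Sum.elim (Sum.elim (fun b => .map .inl (rel b)) fun b => .map .inr (rel' b))
      fun ab : α × α' =>
        ⁅(FreeGroup.of (Sum.inl ab.1) : FreeGroup (α ⊕ α')), FreeGroup.of (Sum.inr ab.2)⁆
  refine ⟨(φ.comp p).prod (ψ.comp q), R, ?_, le_antisymm ?_ ?_⟩
  · rintro ⟨x, y⟩
    obtain ⟨x, rfl⟩ := hφ x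
    obtain ⟨y, rfl⟩ := hψ y
    exact ⟨.map .inl x * .map .inr y, by simp [p0, p1, q0, q1]⟩
  · refine Subgroup.normalClosure_le_normal ?_
    rintro _ ⟨(b | b) | ⟨a, b⟩, rfl⟩
    · have : rel b ∈ φ.ker := hr ▸ Subgroup.subset_normalClosure ⟨b, rfl⟩
      simp [R, p0, q0, MonoidHom.mem_ker.1 this]
    · have : rel' b ∈ ψ.ker := hr' ▸ Subgroup.subset_normalClosure ⟨b, rfl⟩
      simp [R, p1, q1, MonoidHom.mem_ker.1 this]
    · simp [R, p, q, commutatorElement_def]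
  · intro z hz
    have hz' : φ (p z) = 1 ∧ ψ (q z) = 1 := by simpa using hz
    set N := Subgroup.normalClosure (Set.range R)
    have hc := FreeGroup.mk_eq_mul_of_commute (QuotientGroup.mk' N) (fun a b => by
      rw [← commutatorElement_eq_one_iff_commute, ← map_commutatorElement]
      exact (QuotientGroup.eq_one_iff _).2 (Subgroup.subset_normalClosure ⟨.inr (a, b), rfl⟩)) z
    have h1 : FreeGroup.map Sum.inl (p z) ∈ N := by
      have : Subgroup.normalClosure (Set.range rel) ≤ N.comap (FreeGroup.map Sum.inl) := by
        refine Subgroup.normalClosure_le_normal ?_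
        rintro _ ⟨b, rfl⟩
        exact Subgroup.subset_normalClosure ⟨.inl (.inl b), rfl⟩
      exact this (hr ▸ hz'.1)
    have h2 : FreeGroup.map Sum.inr (q z) ∈ N := by
      have : Subgroup.normalClosure (Set.range rel') ≤ N.comap (FreeGroup.map Sum.inr) := by
        refine Subgroup.normalClosure_le_normal ?_
        rintro _ ⟨b, rfl⟩
        exact Subgroup.subset_normalClosure ⟨.inl (.inr b), rfl⟩
      exact this (hr' ▸ hz'.2)
    rw [← QuotientGroup.eq_one_iff] at h1 h2 ⊢
    change (QuotientGroup.mk' N) z = 1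
    rw [hc]
    change ((FreeGroup.map Sum.inl (p z) : FreeGroup (α ⊕ α')) : FreeGroup (α ⊕ α') ⧸ N) *
      ((FreeGroup.map Sum.inr (q z) : FreeGroup (α ⊕ α')) : FreeGroup (α ⊕ α') ⧸ N) = 1
    rw [h1, h2, one_mul]

/-! ### Perfect central extensions and generators of their kernels -/

theorem Subgroup.normal_of_le_center {E : Type*} [Group E] {H : Subgroup E}
    (h : H ≤ Subgroup.center E) : H.Normal :=
  ⟨fun x hx g => by rwa [(Subgroup.mem_center_iff.1 (h hx) g), mul_inv_cancel_right]⟩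

theorem commutatorElement_mul_center {E : Type*} [Group E] {x y z w : E}
    (hz : z ∈ Subgroup.center E) (hw : w ∈ Subgroup.center E) : ⁅x * z, y * w⁆ = ⁅x, y⁆ := by
  have h1 : ∀ g, Commute z g := fun g => (Subgroup.mem_center_iff.1 hz g).symm
  have h2 : ∀ g, Commute w g := fun g => (Subgroup.mem_center_iff.1 hw g).symm
  rw [commutatorElement_mul_left_eq_conj_mul, (h1 _).commutator_eq, mul_one, mul_inv_cancel,
    one_mul, commutatorElement_mul_right_eq_mul_conj, (h2 x).symm.commutator_eq, mul_one,
    mul_inv_cancel_right]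

section CentralExtension

variable {E Λ : Type*} [Group E] [Group Λ] {π : E →* Λ}

/-- The commutator of a subgroup depends only on its image modulo a central subgroup. -/
theorem Subgroup.commutator_le_of_map_le (hz : π.ker ≤ Subgroup.center E) {S T : Subgroup E}
    (h : T.map π ≤ S.map π) : ⁅T, T⁆ ≤ ⁅S, S⁆ := by
  have key : ∀ x ∈ T, ∃ s ∈ S, ∃ z ∈ Subgroup.center E, x = s * z := fun x hx => by
    obtain ⟨s, hs, hsx⟩ := h ⟨x, hx, rfl⟩
    exact ⟨s, hs, s⁻¹ * x, hz (by simp [MonoidHom.mem_ker, hsx]), by simp⟩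
  rw [Subgroup.commutator_le]
  intro x hx y hy
  obtain ⟨s, hs, z, hz, rfl⟩ := key x hx
  obtain ⟨t, ht, w, hw, rfl⟩ := key y hy
  rw [commutatorElement_mul_center hz hw]
  exact Subgroup.commutator_mem_commutator hs ht

/-- A subgroup of a perfect central extension which maps onto the quotient is everything. -/
theorem Subgroup.eq_top_of_map_eq_top (hz : π.ker ≤ Subgroup.center E)
    (hE : _root_.commutator E = ⊤) {S : Subgroup E} (h : S.map π = ⊤) : S = ⊤ := by
  rw [← top_le_iff, ← hE, _root_.commutator_def]
  exact (Subgroup.commutator_le_of_map_le hz (h ▸ le_top)).trans (Subgroup.commutator_le_self S)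

end CentralExtension

/-- Every perfect central extension of `Γ` (by a group in `Type`) has a kernel generated by a
family indexed by `σ`. -/
def SchurGeneratedBy (σ : Type) (Γ : Type*) [Group Γ] : Prop :=
  ∀ (E : Type) [Group E] (π : E →* Γ), Function.Surjective π → π.ker ≤ Subgroup.center E →
    commutator E = ⊤ → ∃ z : σ → E, Subgroup.closure (Set.range z) = π.ker

theorem SchurGeneratedBy.congr {σ τ : Type} {Γ Δ : Type*} [Group Γ] [Group Δ]
    (h : SchurGeneratedBy σ Γ) (e : σ ≃ τ) (f : Γ ≃* Δ) : SchurGeneratedBy τ Δ := by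
  intro E _ π hπ hz hE
  have hk : (f.symm.toMonoidHom.comp π).ker = π.ker := by ext; simp
  obtain ⟨z, h1⟩ := h E (f.symm.toMonoidHom.comp π) (f.symm.surjective.comp hπ) (hk ▸ hz) hE
  refine ⟨z ∘ e.symm, ?_⟩
  rw [e.symm.surjective.range_comp, h1, hk]

/-- In a perfect central extension `π : E → Λ`, let `P` be a perfect normal subgroup of `Λ` which
is carried isomorphically onto `Γ` by `p`. Then the derived subgroup `D` of the preimage of `P`
maps onto `P`, and `D ∩ ker π` is generated by as many elements as `SchurGeneratedBy` allows. -/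
theorem SchurGeneratedBy.exists_closure_eq {σ : Type} {E : Type} {Λ Γ : Type*} [Group E] [Group Λ]
    [Group Γ] (h : SchurGeneratedBy σ Γ) {π : E →* Λ} (hπ : Function.Surjective π)
    (hz : π.ker ≤ Subgroup.center E) {P : Subgroup Λ} (hP : ⁅P, P⁆ = P) (p : Λ →* Γ)
    (hp : P.map p = ⊤) (hp' : ∀ x ∈ P, p x = 1 → x = 1) :
    ⁅P.comap π, P.comap π⁆.map π = P ∧ ∃ z : σ → E, (∀ i, z i ∈ π.ker) ∧
      ∀ x ∈ ⁅P.comap π, P.comap π⁆, π x = 1 → x ∈ Subgroup.closure (Set.range z) := by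
  set D := ⁅P.comap π, P.comap π⁆ with hD
  have h1 : D.map π = P := by
    rw [hD, Subgroup.map_commutator, Subgroup.map_comap_eq_self_of_surjective hπ, hP]
  -- `D` is perfect: it has the same image `P` as the full preimage of `P`, and commutators are
  -- insensitive to central factors.
  have hDD : ⁅D, D⁆ = D := by
    refine le_antisymm (Subgroup.commutator_le_self D) ?_
    conv_lhs => rw [hD]
    refine Subgroup.commutator_le_of_map_le hz ?_
    rw [h1, Subgroup.map_comap_eq_self_of_surjective hπ]
  have hperf : commutator D = ⊤ := by
    apply Subgroup.map_injective D.subtype_injective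
    rw [Subgroup.map_subtype_commutator, hDD, ← MonoidHom.range_eq_map, D.range_subtype]
  let f : D →* Γ := (p.comp π).comp D.subtype
  have hf : Function.Surjective f := by
    rw [← MonoidHom.range_eq_top, MonoidHom.range_eq_map, ← Subgroup.map_map,
      ← MonoidHom.range_eq_map, D.range_subtype, ← Subgroup.map_map, h1, hp]
  have hker : ∀ x : D, f x = 1 → π x = 1 := fun x hx =>
    hp' _ (h1 ▸ ⟨x, x.2, rfl⟩) hx
  obtain ⟨z, hzz⟩ := h D f hf (fun x hx => by
    rw [Subgroup.mem_center_iff]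
    intro y
    exact Subtype.ext (Subgroup.mem_center_iff.1 (hz (hker x hx)) y)) hperf
  refine ⟨h1, fun i => z i, fun i => ?_, fun x hx hx1 => ?_⟩
  · exact hker _ (show z i ∈ f.ker from hzz ▸ Subgroup.subset_closure ⟨i, rfl⟩)
  · have h2 : (⟨x, hx⟩ : D) ∈ f.ker := by simp [f, hx1]
    rw [← hzz] at h2
    have h3 := Subgroup.mem_map_of_mem D.subtype h2
    rw [MonoidHom.map_closure, ← Set.range_comp] at h3
    exact h3

/-- This replaces the Künneth formula for `H₂` of a product of perfect groups. The derived subgroups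
of the preimages of the two factors generate `E`. If a product `a * b` of their elements lies in the
kernel, then so do `a` and `b`, since the factors meet trivially. -/
theorem SchurGeneratedBy.prod {σ τ : Type} {Γ Δ : Type*} [Group Γ] [Group Δ]
    (h : SchurGeneratedBy σ Γ) (h' : SchurGeneratedBy τ Δ) (hΓ : commutator Γ = ⊤)
    (hΔ : commutator Δ = ⊤) : SchurGeneratedBy (σ ⊕ τ) (Γ × Δ) := by
  intro E _ π hπ hz hE
  rw [commutator_def] at hΓ hΔ
  let P : Subgroup (Γ × Δ) := Subgroup.prod ⊤ ⊥
  let Q : Subgroup (Γ × Δ) := Subgroup.prod ⊥ ⊤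
  obtain ⟨hP, z, hz0, hz1⟩ := h.exists_closure_eq hπ hz (P := P)
    (by simp [P, Subgroup.commutator_prod_prod, hΓ]) (MonoidHom.fst Γ Δ)
    (by rw [eq_top_iff]; intro x _; exact ⟨(x, 1), by simp [P, Subgroup.mem_prod], rfl⟩)
    (by rintro ⟨x, y⟩ hx h1
        simp only [P, Subgroup.mem_prod, Subgroup.mem_bot] at hx
        exact Prod.ext h1 hx.2)
  obtain ⟨hQ, w, hw0, hw1⟩ := h'.exists_closure_eq hπ hz (P := Q)
    (by simp [Q, Subgroup.commutator_prod_prod, hΔ]) (MonoidHom.snd Γ Δ)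
    (by rw [eq_top_iff]; intro x _; exact ⟨(1, x), by simp [Q, Subgroup.mem_prod], rfl⟩)
    (by rintro ⟨x, y⟩ hx h1
        simp only [Q, Subgroup.mem_prod, Subgroup.mem_bot] at hx
        exact Prod.ext hx.1 h1)
  have : P.Normal := Subgroup.prod_normal _ _
  have : Q.Normal := Subgroup.prod_normal _ _
  set D := ⁅P.comap π, P.comap π⁆
  set D' := ⁅Q.comap π, Q.comap π⁆
  have htop : D ⊔ D' = ⊤ := by
    refine Subgroup.eq_top_of_map_eq_top hz hE ?_
    rw [Subgroup.map_sup, hP, hQ, eq_top_iff]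
    rintro ⟨x, y⟩ -
    rw [show (x, y) = (x, 1) * (1, y) by simp]
    exact mul_mem (Subgroup.mem_sup_left (by simp [P, Subgroup.mem_prod]))
      (Subgroup.mem_sup_right (by simp [Q, Subgroup.mem_prod]))
  refine ⟨Sum.elim z w, le_antisymm ?_ ?_⟩
  · rw [Subgroup.closure_le]
    rintro _ ⟨i | i, rfl⟩
    · exact hz0 i
    · exact hw0 i
  · intro x hx
    obtain ⟨a, ha, b, hb, rfl⟩ := Subgroup.mem_sup_of_normal_right.1 (htop ▸ Subgroup.mem_top x)
    have ha1 : π a ∈ P := hP ▸ Subgroup.mem_map_of_mem π ha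
    have hb1 : π b ∈ Q := hQ ▸ Subgroup.mem_map_of_mem π hb
    have hab : π a * π b = 1 := by rw [← map_mul]; exact hx
    simp only [P, Q, Subgroup.mem_prod, Subgroup.mem_bot] at ha1 hb1
    have e1 := congrArg Prod.fst hab
    have e2 := congrArg Prod.snd hab
    simp only [Prod.fst_mul, Prod.snd_mul, Prod.fst_one, Prod.snd_one, ha1.2, hb1.1, mul_one,
      one_mul] at e1 e2
    refine mul_mem (Subgroup.closure_mono ?_ (hz1 a ha (Prod.ext e1 ha1.2)))
      (Subgroup.closure_mono ?_ (hw1 b hb (Prod.ext hb1.1 e2)))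
    · rintro _ ⟨i, rfl⟩; exact ⟨.inl i, rfl⟩
    · rintro _ ⟨i, rfl⟩; exact ⟨.inr i, rfl⟩

/-- The kernel of a perfect central extension of a finitely presented group is generated by as
many elements as there are relators. -/
theorem PresentedBy.schurGeneratedBy {α β : Type} {Γ : Type*} [Group Γ] (h : PresentedBy α β Γ) :
    SchurGeneratedBy β Γ := by
  intro E _ π hπ hz hE
  obtain ⟨φ, rel, hφ, hr⟩ := h
  obtain ⟨f, hf⟩ := FreeGroup.exists_comp_eq hπ φ
  have hfs : Function.Surjective f := by
    rw [← MonoidHom.range_eq_top]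
    refine Subgroup.eq_top_of_map_eq_top hz hE (top_le_iff.1 fun x _ => ?_)
    obtain ⟨y, rfl⟩ := hφ x
    exact ⟨f y, ⟨y, rfl⟩, hf y⟩
  have hle : Subgroup.closure (Set.range fun b => f (rel b)) ≤ π.ker := by
    rw [Subgroup.closure_le]
    rintro _ ⟨b, rfl⟩
    have : rel b ∈ φ.ker := hr ▸ Subgroup.subset_normalClosure ⟨b, rfl⟩
    simpa [hf] using this
  refine ⟨fun b => f (rel b), le_antisymm hle fun x hx => ?_⟩
  obtain ⟨y, rfl⟩ := hfs x
  have hy : y ∈ Subgroup.normalClosure (Set.range rel) := by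
    rw [hr, MonoidHom.mem_ker, ← hf]; exact hx
  -- The images of the relators are central, so the subgroup they generate is normal and no
  -- conjugates are needed.
  have := Subgroup.normal_of_le_center (hle.trans hz)
  have h1 : Subgroup.normalClosure (Set.range rel) ≤
      (Subgroup.closure (Set.range fun b => f (rel b))).comap f := by
    refine Subgroup.normalClosure_le_normal ?_
    rintro _ ⟨b, rfl⟩
    exact Subgroup.subset_closure ⟨b, rfl⟩
  exact h1 hy

/-- If adding the relators `rel` makes the free group a perfect central extension of `Γ`, then a
presentation of `Γ` is obtained by adding relators that generate the kernel. -/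
theorem SchurGeneratedBy.presentedBy {α β σ : Type} {Γ : Type*} [Group Γ]
    (h : SchurGeneratedBy σ Γ) {φ : FreeGroup α →* Γ} (hφ : Function.Surjective φ)
    {rel : β → FreeGroup α} (hr : ∀ b, φ (rel b) = 1)
    (hperf : commutator (FreeGroup α ⧸ Subgroup.normalClosure (Set.range rel)) = ⊤)
    (hcent : ∀ x, φ x = 1 → ∀ y, ⁅x, y⁆ ∈ Subgroup.normalClosure (Set.range rel)) :
    PresentedBy α (β ⊕ σ) Γ := by
  set N := Subgroup.normalClosure (Set.range rel) with hN
  have hle : N ≤ φ.ker := by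
    refine Subgroup.normalClosure_le_normal ?_
    rintro _ ⟨b, rfl⟩
    exact hr b
  let π : FreeGroup α ⧸ N →* Γ := QuotientGroup.lift N φ hle
  obtain ⟨z, hz⟩ := h _ π (QuotientGroup.lift_surjective_of_surjective N φ hφ hle) (by
    intro x hx
    obtain ⟨x, rfl⟩ := QuotientGroup.mk_surjective x
    have hx' : φ x = 1 := hx
    rw [Subgroup.mem_center_iff]
    intro y
    obtain ⟨y, rfl⟩ := QuotientGroup.mk_surjective y
    refine (Commute.eq (?_ : Commute (QuotientGroup.mk' N x) (QuotientGroup.mk' N y))).symm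
    rw [← commutatorElement_eq_one_iff_commute, ← map_commutatorElement]
    exact (QuotientGroup.eq_one_iff _).2 (hcent x hx' y)) hperf
  choose z' hz' using fun s => QuotientGroup.mk_surjective (z s)
  refine ⟨φ, Sum.elim rel z', hφ, le_antisymm ?_ ?_⟩
  · refine Subgroup.normalClosure_le_normal ?_
    rintro _ ⟨b | s, rfl⟩
    · exact hr b
    · have h1 : z s ∈ π.ker := hz ▸ Subgroup.subset_closure ⟨s, rfl⟩
      rw [← hz' s] at h1
      exact h1
  · intro x hx
    have h1 : (x : FreeGroup α ⧸ N) ∈ π.ker := hx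
    have h2 : Subgroup.closure (Set.range z) ≤
        (Subgroup.normalClosure (Set.range (Sum.elim rel z'))).map (QuotientGroup.mk' N) := by
      rw [Subgroup.closure_le]
      rintro _ ⟨s, rfl⟩
      exact ⟨z' s, Subgroup.subset_normalClosure ⟨.inr s, rfl⟩, hz' s⟩
    rw [← hz] at h1
    obtain ⟨y, hy, hyx⟩ := h2 h1
    have h3 : y⁻¹ * x ∈ Subgroup.normalClosure (Set.range (Sum.elim rel z')) := by
      refine Subgroup.normalClosure_mono ?_ (QuotientGroup.eq.1 hyx)
      rintro _ ⟨b, rfl⟩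
      exact ⟨.inl b, rfl⟩
    simpa using mul_mem hy h3

/-! ### Doubling a presentation of a perfect group -/

/-- A presentation of `Γ × Γ` for perfect `Γ` in which the relators of `Γ` are used only once, for
the diagonal copy of `Γ`. -/
theorem PresentedBy.prod_self {α β σ : Type} {Γ : Type*} [Group Γ] (h : PresentedBy α β Γ)
    (hΓ : commutator Γ = ⊤) (hσ : SchurGeneratedBy σ (Γ × Γ)) :
    PresentedBy (α ⊕ α) (((β ⊕ α × α) ⊕ (α ⊕ α)) ⊕ σ) (Γ × Γ) := by
  obtain ⟨φ, rel, hφ, hr⟩ := h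
  -- Since `Γ` is perfect, each generator is represented by a word in the derived subgroup; imposing
  -- these equalities in both factors makes the quotient perfect.
  have hw : ∀ a, ∃ w ∈ commutator (FreeGroup α), φ w = φ (.of a) := fun a => by
    have : (commutator (FreeGroup α)).map φ = ⊤ := by
      rw [commutator_def, Subgroup.map_commutator, Subgroup.map_top_of_surjective φ hφ,
        ← commutator_def, hΓ]
    obtain ⟨w, h1, h2⟩ := (this ▸ Subgroup.mem_top (φ (.of a)) :
      φ (.of a) ∈ (commutator (FreeGroup α)).map φ)
    exact ⟨w, h1, h2⟩
  choose w hw1 hw2 using hw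
  let i₀ : FreeGroup α →* FreeGroup (α ⊕ α) := FreeGroup.map Sum.inl
  let i₁ : FreeGroup α →* FreeGroup (α ⊕ α) := FreeGroup.map Sum.inr
  let δ : FreeGroup α →* FreeGroup (α ⊕ α) :=
    FreeGroup.lift fun a => .of (.inl a) * .of (.inr a)
  let Φ : FreeGroup (α ⊕ α) →* Γ × Γ :=
    FreeGroup.lift (Sum.elim (fun a => (φ (.of a), 1)) fun a => (1, φ (.of a)))
  have Φ0 : ∀ x, Φ (i₀ x) = (φ x, 1) := fun x => by
    have : Φ.comp i₀ = (MonoidHom.inl Γ Γ).comp φ := by ext <;> simp [Φ, i₀]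
    exact DFunLike.congr_fun this x
  have Φ1 : ∀ x, Φ (i₁ x) = (1, φ x) := fun x => by
    have : Φ.comp i₁ = (MonoidHom.inr Γ Γ).comp φ := by ext <;> simp [Φ, i₁]
    exact DFunLike.congr_fun this x
  have Φδ : ∀ x, Φ (δ x) = (φ x, φ x) := fun x => by
    have : Φ.comp δ = φ.prod φ := by ext <;> simp [Φ, δ]
    exact DFunLike.congr_fun this x
  let R : (β ⊕ α × α) ⊕ (α ⊕ α) → FreeGroup (α ⊕ α) :=
    Sum.elim (Sum.elim (fun b => δ (rel b))
      fun ab : α × α =>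
        ⁅(FreeGroup.of (Sum.inl ab.1) : FreeGroup (α ⊕ α)), FreeGroup.of (Sum.inr ab.2)⁆)
      (Sum.elim (fun a => (FreeGroup.of (Sum.inl a))⁻¹ * i₀ (w a))
        fun a => (FreeGroup.of (Sum.inr a))⁻¹ * i₁ (w a))
  set N := Subgroup.normalClosure (Set.range R) with hN
  let q : FreeGroup (α ⊕ α) →* FreeGroup (α ⊕ α) ⧸ N := QuotientGroup.mk' N
  have hq : ∀ x, q x = 1 ↔ x ∈ N := fun x => QuotientGroup.eq_one_iff x
  have hR : ∀ j, q (R j) = 1 := fun j => (hq _).2 (Subgroup.subset_normalClosure ⟨j, rfl⟩)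
  have hcomm : ∀ x y, Commute (q (i₀ x)) (q (i₁ y)) :=
    FreeGroup.commute_of_commute_of (q.comp i₀) (q.comp i₁) fun a b => by
      rw [← commutatorElement_eq_one_iff_commute]
      simpa [R, i₀, i₁, map_commutatorElement] using hR (.inl (.inr (a, b)))
  have hδ : ∀ x, q (δ x) = q (i₀ x) * q (i₁ x) := fun x => by
    have : q.comp δ = (MonoidHom.noncommCoprod (q.comp i₀) (q.comp i₁) hcomm).comp
        ((MonoidHom.id _).prod (MonoidHom.id _)) := by
      ext a; simp [δ, i₀, i₁]
    exact DFunLike.congr_fun this x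
  have hrelδ : ∀ x, φ x = 1 → q (i₀ x) * q (i₁ x) = 1 := fun x hx => by
    have h1 : Subgroup.normalClosure (Set.range rel) ≤ N.comap δ := by
      refine Subgroup.normalClosure_le_normal ?_
      rintro _ ⟨b, rfl⟩
      exact Subgroup.subset_normalClosure ⟨.inl (.inl b), rfl⟩
    rw [← hδ, hq]
    exact h1 (hr ▸ hx)
  have hdec : ∀ x, ∃ u v, q x = q (i₀ u) * q (i₁ v) := fun x =>
    ⟨_, _, FreeGroup.mk_eq_mul_of_commute q
      (fun a b => by simpa [i₀, i₁] using hcomm (.of a) (.of b)) x⟩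
  have hΦR : ∀ j, Φ (R j) = 1 := by
    rintro ((b | ⟨a, b⟩) | (a | a))
    · have : rel b ∈ φ.ker := hr ▸ Subgroup.subset_normalClosure ⟨b, rfl⟩
      simp [R, Φδ, MonoidHom.mem_ker.1 this]
    · simp [R, Φ, commutatorElement_def]
    · simp only [R, Sum.elim_inr, Sum.elim_inl, map_mul, map_inv, Φ0, hw2]
      simp [Φ]
    · simp only [R, Sum.elim_inr, map_mul, map_inv, Φ1, hw2]
      simp [Φ]
  refine SchurGeneratedBy.presentedBy hσ (φ := Φ) (rel := R) ?_ ?_ ?_ ?_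
  · rintro ⟨x, y⟩
    obtain ⟨x, rfl⟩ := hφ x
    obtain ⟨y, rfl⟩ := hφ y
    exact ⟨i₀ x * i₁ y, by simp [Φ0, Φ1]⟩
  · exact hΦR
  · have hc : ∀ i : FreeGroup α →* FreeGroup (α ⊕ α), ∀ x ∈ commutator (FreeGroup α),
        q (i x) ∈ commutator (FreeGroup (α ⊕ α) ⧸ N) := fun i x hx => by
      have := Subgroup.mem_map_of_mem (q.comp i) hx
      rw [commutator_def, Subgroup.map_commutator] at this
      exact Subgroup.commutator_mono le_top le_top this
    have h1 : ∀ a, q (.of a) ∈ commutator (FreeGroup (α ⊕ α) ⧸ N) := by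
      rintro (a | a)
      · have := hR (.inr (.inl a))
        simp only [R, Sum.elim_inr, Sum.elim_inl, map_mul, map_inv, inv_mul_eq_one] at this
        exact this ▸ hc i₀ _ (hw1 a)
      · have := hR (.inr (.inr a))
        simp only [R, Sum.elim_inr, map_mul, map_inv, inv_mul_eq_one] at this
        exact this ▸ hc i₁ _ (hw1 a)
    rw [← top_le_iff, ← Subgroup.map_top_of_surjective q (QuotientGroup.mk'_surjective N),
      ← FreeGroup.closure_range_of, MonoidHom.map_closure, Subgroup.closure_le]
    rintro _ ⟨_, ⟨a, rfl⟩, rfl⟩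
    exact h1 a
  · intro x hx
    -- Write `x` as `i₀ u * i₁ v` with `u`, `v` trivial in `Γ`. The diagonal relators make `i₀ u`
    -- inverse to `i₁ u`, so it commutes with the first factor as well as with the second. The same
    -- holds for `i₁ v`, hence `x` is central.
    have key : ∀ y, Commute (q x) (q y) := fun y => by
      obtain ⟨u, v, huv⟩ := hdec x
      obtain ⟨s, t, hst⟩ := hdec y
      have h1 : Φ x = (φ u, φ v) := by
        have h2 : x⁻¹ * (i₀ u * i₁ v) ∈ N := by
          rw [← hq, map_mul, map_inv, huv, map_mul, inv_mul_cancel]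
        have h3 : N ≤ Φ.ker := by
          refine Subgroup.normalClosure_le_normal ?_
          rintro _ ⟨j, rfl⟩
          exact hΦR j
        have h4 := h3 h2
        rw [MonoidHom.mem_ker, map_mul, map_inv, inv_mul_eq_one, map_mul, Φ0, Φ1] at h4
        simpa using h4
      rw [hx] at h1
      have hu := hrelδ u (congrArg Prod.fst h1).symm
      have hv := hrelδ v (congrArg Prod.snd h1).symm
      rw [huv, hst]
      have cu : Commute (q (i₀ u)) (q (i₀ s)) := by
        rw [eq_inv_of_mul_eq_one_left hu]
        exact (hcomm s u).symm.inv_left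
      have cv : Commute (q (i₁ v)) (q (i₁ t)) := by
        rw [eq_inv_of_mul_eq_one_right hv]
        exact (hcomm v t).inv_left
      exact (cu.mul_right (hcomm u t)).mul_left ((hcomm s v).symm.mul_right cv)
    intro y
    rw [← hN, ← hq, map_commutatorElement]
    exact (key _).commutator_eq

/-! ### Cocycles and the number of relators -/

/-- A `2`-cocycle on `Γ` with trivial coefficients. -/
def IsTwoCocycle {Γ A : Type*} [Group Γ] [AddCommGroup A] (f : Γ → Γ → A) : Prop :=
  ∀ x y z, f x y + f (x * y) z = f y z + f x (y * z)

/-- A `2`-coboundary on `Γ` with trivial coefficients. -/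
def IsTwoCoboundary {Γ A : Type*} [Group Γ] [AddCommGroup A] (f : Γ → Γ → A) : Prop :=
  ∃ ψ : Γ → A, ∀ x y, f x y = ψ x + ψ y - ψ (x * y)

section Cocycle

variable {Γ A : Type*} [Group Γ] [AddCommGroup A] {f : Γ → Γ → A}

theorem IsTwoCocycle.apply_one_left (hf : IsTwoCocycle f) (x : Γ) : f 1 x = f 1 1 := by
  have := hf 1 1 x
  simp only [mul_one, one_mul] at this
  rw [add_comm] at this
  exact (add_left_cancel this).symm

theorem IsTwoCocycle.apply_one_right (hf : IsTwoCocycle f) (x : Γ) : f x 1 = f 1 1 := by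
  have := hf x 1 1
  simp only [mul_one] at this
  exact add_right_cancel this

theorem IsTwoCocycle.comp {Δ : Type*} [Group Δ] (hf : IsTwoCocycle f) (p : Δ →* Γ) :
    IsTwoCocycle fun x y => f (p x) (p y) := fun x y z => by
  simpa using hf (p x) (p y) (p z)

/-- The underlying type of the central extension defined by a `2`-cocycle. -/
@[ext]
structure CocycleExtension (f : Γ → Γ → A) where
  fst : A
  snd : Γ

/-- The central extension defined by a `2`-cocycle. -/
@[reducible]
def CocycleExtension.group (hf : IsTwoCocycle f) : Group (CocycleExtension f) :=
  letI : Mul (CocycleExtension f) := ⟨fun a b => ⟨a.1 + b.1 + f a.2 b.2, a.2 * b.2⟩⟩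
  -- Cocycles are not assumed normalised, hence the correction by `f 1 1` here and in the inverse.
  letI : One (CocycleExtension f) := ⟨⟨-f 1 1, 1⟩⟩
  letI : Inv (CocycleExtension f) := ⟨fun a => ⟨-a.1 - f a.2⁻¹ a.2 - f 1 1, a.2⁻¹⟩⟩
  Group.ofLeftAxioms
    (fun a b c => CocycleExtension.ext
      (by
        have := hf a.2 b.2 c.2
        change a.1 + b.1 + f a.2 b.2 + c.1 + f (a.2 * b.2) c.2 =
          a.1 + (b.1 + c.1 + f b.2 c.2) + f a.2 (b.2 * c.2)
        rw [show a.1 + b.1 + f a.2 b.2 + c.1 + f (a.2 * b.2) c.2 =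
          a.1 + b.1 + c.1 + (f a.2 b.2 + f (a.2 * b.2) c.2) by abel, this]
        abel)
      (mul_assoc _ _ _))
    (fun a => CocycleExtension.ext
      (by
        change -f 1 1 + a.1 + f 1 a.2 = a.1
        rw [hf.apply_one_left a.2]
        exact neg_add_cancel_comm _ _)
      (one_mul _))
    (fun a => CocycleExtension.ext
      (by change -a.1 - f a.2⁻¹ a.2 - f 1 1 + a.1 + f a.2⁻¹ a.2 = -f 1 1; abel)
      (inv_mul_cancel _))

/-- Every `2`-cocycle becomes a coboundary on a free group. -/
theorem IsTwoCocycle.exists_splitting {α : Type*} (hf : IsTwoCocycle f) (φ : FreeGroup α →* Γ) :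
    ∃ q : FreeGroup α → A, ∀ x y, f (φ x) (φ y) = q x + q y - q (x * y) := by
  let := CocycleExtension.group hf
  -- Freeness lifts `φ` to the extension; minus the first coordinate of the lift is the required
  -- cochain.
  let h : FreeGroup α →* CocycleExtension f := FreeGroup.lift fun a => ⟨0, φ (.of a)⟩
  let p : CocycleExtension f →* Γ :=
    { toFun := CocycleExtension.snd, map_one' := rfl, map_mul' := fun _ _ => rfl }
  have hp : ∀ x, (h x).snd = φ x := fun x => by
    have : p.comp h = φ := by ext a; simp [p, h]
    exact DFunLike.congr_fun this x
  refine ⟨fun x => -(h x).fst, fun x y => ?_⟩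
  have : (h (x * y)).fst = (h x).fst + (h y).fst + f (h x).snd (h y).snd := by
    rw [map_mul]; rfl
  simp only [this, hp]
  abel

/-- A splitting of a cocycle over a free group that is trivial on the relators descends. -/
theorem IsTwoCocycle.isTwoCoboundary_of_splitting {α β : Type*} (hf : IsTwoCocycle f)
    {φ : FreeGroup α →* Γ} (hφ : Function.Surjective φ) {rel : β → FreeGroup α}
    (hr : Subgroup.normalClosure (Set.range rel) = φ.ker) {q : FreeGroup α → A}
    (hq : ∀ x y, f (φ x) (φ y) = q x + q y - q (x * y)) (hb : ∀ b, q (rel b) = q 1) :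
    IsTwoCoboundary f := by
  have h1 : f 1 1 = q 1 := by simpa using hq 1 1
  have hR : ∀ g x, φ x = 1 → q (g * x) = q g + q x - q 1 := fun g x hx => by
    have := hq g x
    rw [hx, hf.apply_one_right, h1] at this
    rw [this]; abel
  have hL : ∀ g x, φ x = 1 → q (x * g) = q g + q x - q 1 := fun g x hx => by
    have := hq x g
    rw [hx, hf.apply_one_left, h1] at this
    rw [this]; abel
  -- On the kernel of `φ`, `q - q 1` is additive and invariant under conjugation. Its zeros there
  -- form a normal subgroup containing the relators, hence the whole kernel, and `q` is constant on
  -- the fibres of `φ`.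
  let S : Subgroup (FreeGroup α) :=
    { carrier := {x | φ x = 1 ∧ q x = q 1}
      one_mem' := ⟨map_one φ, rfl⟩
      mul_mem' := fun {x y} hx hy => ⟨by rw [map_mul, hx.1, hy.1, one_mul], by
        rw [hR _ _ hy.1, hx.2, hy.2]; abel⟩
      inv_mem' := fun {x} hx => ⟨by rw [map_inv, hx.1, inv_one], by
        have := hR x⁻¹ x hx.1
        rw [inv_mul_cancel, hx.2] at this
        rw [this]; abel⟩ }
  have : S.Normal := ⟨fun x hx g => ⟨by simp [hx.1], by
    have hc : φ (g * x * g⁻¹) = 1 := by simp [hx.1]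
    have e1 := hL g (g * x * g⁻¹) hc
    rw [inv_mul_cancel_right, hR g x hx.1, hx.2] at e1
    have e2 : q (g * x * g⁻¹) = (q g + q (g * x * g⁻¹) - q 1) - q g + q 1 := by abel
    rw [e2, ← e1]; abel⟩⟩
  have hS : φ.ker ≤ S := by
    rw [← hr]
    refine Subgroup.normalClosure_le_normal ?_
    rintro _ ⟨b, rfl⟩
    exact ⟨show rel b ∈ φ.ker from hr ▸ Subgroup.subset_normalClosure ⟨b, rfl⟩, hb b⟩
  have hconst : ∀ x y, φ x = φ y → q x = q y := fun x y hxy => by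
    have h2 : y⁻¹ * x ∈ φ.ker := by rw [MonoidHom.mem_ker, map_mul, map_inv, hxy, inv_mul_cancel]
    have := hR y (y⁻¹ * x) h2
    rw [mul_inv_cancel_left, (hS h2).2] at this
    rw [this]; abel
  choose s hs using hφ
  refine ⟨fun g => q (s g), fun x y => ?_⟩
  simp only [hconst (s (x * y)) (s x * s y) (by simp [hs]), ← hq, hs]

end Cocycle

/-- The number of relators is at least the number of cocycles, over a field, which are linearly
independent modulo coboundaries. -/
theorem PresentedBy.card_le_of_independent {α β : Type} {Γ : Type*} [Group Γ] [Fintype β]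
    (h : PresentedBy α β Γ) {K ι : Type*} [Field K] [Fintype ι] {f : ι → Γ → Γ → K}
    (hf : ∀ i, IsTwoCocycle (f i))
    (hind : ∀ c : ι → K, IsTwoCoboundary (fun x y => ∑ i, c i * f i x y) → c = 0) :
    Fintype.card ι ≤ Fintype.card β := by
  obtain ⟨φ, rel, hφ, hr⟩ := h
  choose q hq using fun i => (hf i).exists_splitting φ
  -- Evaluate the combined splitting on the relators. If all values vanish, the splitting descends
  -- and the combination of cocycles is a coboundary.
  let T : (ι → K) →ₗ[K] (β → K) :=
    { toFun := fun c b => ∑ i, c i * (q i (rel b) - q i 1)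
      map_add' := fun c d => by ext b; simp [add_mul, Finset.sum_add_distrib]
      map_smul' := fun a c => by ext b; simp [mul_assoc, Finset.mul_sum] }
  have hT : Function.Injective T := by
    rw [injective_iff_map_eq_zero]
    intro c hc
    refine hind c (IsTwoCocycle.isTwoCoboundary_of_splitting (fun x y z => ?_) hφ hr
      (q := fun x => ∑ i, c i * q i x) (fun x y => ?_) fun b => ?_)
    · simp only [← Finset.sum_add_distrib, ← mul_add, hf _ x y z]
    · simp only [← Finset.sum_add_distrib, ← Finset.sum_sub_distrib, hq, mul_add, mul_sub]
    · have := congrFun hc b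
      simp only [T, LinearMap.coe_mk, AddHom.coe_mk, mul_sub, Finset.sum_sub_distrib,
        Pi.zero_apply, sub_eq_zero] at this
      exact this
  simpa using LinearMap.finrank_le_finrank_of_injective hT

/-- A nontrivial finitely generated module has a nonzero map to a residue field. -/
theorem Module.Finite.exists_ne_zero_quotient (k M : Type*) [CommRing k] [AddCommGroup M]
    [Module k M] [Module.Finite k M] [Nontrivial M] :
    ∃ I : Ideal k, I.IsMaximal ∧ ∃ θ : M →ₗ[k] k ⧸ I, θ ≠ 0 := by
  obtain ⟨N, hN, -⟩ := (eq_top_or_exists_le_coatom (⊥ : Submodule k M)).resolve_left bot_ne_top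
  have : IsSimpleModule k (M ⧸ N) := isSimpleModule_iff_isCoatom.2 hN
  obtain ⟨I, hI, ⟨e⟩⟩ := isSimpleModule_iff_quot_maximal.1 this
  refine ⟨I, hI, e.toLinearMap ∘ₗ N.mkQ, fun h => hN.1 (top_le_iff.1 fun x _ => ?_)⟩
  have := LinearMap.congr_fun h x
  simpa using this

/-! ### From integral homology to commutators, cocycles and central extensions -/

section Homology

open groupHomology Finsupp

variable {G : Type u} [Group G]

/-- The trivial representation that serves as coefficients of `integralHomology`. -/
abbrev integralCoefficients (G : Type u) [Group G] : Rep (ULift.{u} ℤ) G :=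
  Rep.trivial (ULift.{u} ℤ) G (ULift.{u} ℤ)

/-- The boundary map from integral inhomogeneous `2`-chains to `1`-chains. -/
noncomputable def chainBoundary₂ (G : Type u) [Group G] :
    (G × G →₀ ULift.{u} ℤ) →ₗ[ULift.{u} ℤ] (G →₀ ULift.{u} ℤ) :=
  (d₂₁ (integralCoefficients G)).hom

/-- The boundary map from integral inhomogeneous `3`-chains to `2`-chains. -/
noncomputable def chainBoundary₃ (G : Type u) [Group G] :
    (G × G × G →₀ ULift.{u} ℤ) →ₗ[ULift.{u} ℤ] (G × G →₀ ULift.{u} ℤ) :=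
  (d₃₂ (integralCoefficients G)).hom

theorem chainBoundary₂_single (x y : G) (a : ULift.{u} ℤ) :
    chainBoundary₂ G (single (x, y) a) = single y a - single (x * y) a + single x a :=
  d₂₁_single (A := integralCoefficients G) (x, y) a

theorem chainBoundary₃_single (x y z : G) (a : ULift.{u} ℤ) :
    chainBoundary₃ G (single (x, y, z) a) =
      single (y, z) a - single (x * y, z) a + single (x, y * z) a - single (x, y) a :=
  d₃₂_single (A := integralCoefficients G) (x, y, z) a

theorem exists_chainBoundary₂_eq (h : Subsingleton (integralHomology G 1)) (x : G →₀ ULift.{u} ℤ) :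
    ∃ c : G × G →₀ ULift.{u} ℤ, chainBoundary₂ G c = x := by
  have h1 : x ∈ cycles₁ (integralCoefficients G) := by rw [cycles₁_eq_top_of_isTrivial]; trivial
  exact (H1π_eq_zero_iff (A := integralCoefficients G) ⟨x, h1⟩).1 (h.elim _ _)

theorem exists_chainBoundary₃_eq (h : Subsingleton (integralHomology G 2))
    (x : G × G →₀ ULift.{u} ℤ) (hx : chainBoundary₂ G x = 0) :
    ∃ c : G × G × G →₀ ULift.{u} ℤ, chainBoundary₃ G c = x :=
  (H2π_eq_zero_iff (A := integralCoefficients G) ⟨x, hx⟩).1 (h.elim _ _)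

/-- Sending `g` to its class in the abelianization extends linearly to chains and kills boundaries;
every `1`-chain `single g 1` is a boundary. -/
theorem commutator_eq_top_of_subsingleton (h : Subsingleton (integralHomology G 1)) :
    commutator G = ⊤ := by
  rw [eq_top_iff]
  intro g _
  obtain ⟨c, hc⟩ := exists_chainBoundary₂_eq h (single g 1)
  let L : (G →₀ ULift.{u} ℤ) →ₗ[ULift.{u} ℤ] Additive (Abelianization G) :=
    linearCombination _ fun g => Additive.ofMul (Abelianization.of g)
  have h1 : L ∘ₗ chainBoundary₂ G = 0 := by
    ext ⟨x, y⟩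
    simp only [LinearMap.comp_apply, lsingle_apply, LinearMap.zero_apply]
    rw [chainBoundary₂_single]
    simp only [L, map_add, map_sub, linearCombination_single, one_smul, map_mul, ofMul_mul]
    abel_nf
  have h2 : L (single g 1) = 0 := by
    rw [← hc]; exact LinearMap.congr_fun h1 c
  simp only [L, linearCombination_single, one_smul, ofMul_eq_zero] at h2
  exact (QuotientGroup.eq_one_iff g).1 h2

/-- The class of `single g 1` modulo boundaries is multiplicative in `g`, with values in an abelian
group. On a perfect group it is trivial, so all `1`-chains are boundaries. -/
theorem commutator_ne_top_of_nontrivial (h : Nontrivial (integralHomology G 1)) :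
    commutator G ≠ ⊤ := by
  intro hG
  let M := (G →₀ ULift.{u} ℤ) ⧸ LinearMap.range (chainBoundary₂ G)
  have hmk : ∀ x y : G, (Submodule.Quotient.mk (single (x * y) 1) : M) =
      Submodule.Quotient.mk (single x 1) + Submodule.Quotient.mk (single y 1) := fun x y => by
    rw [← Submodule.Quotient.mk_add, eq_comm, Submodule.Quotient.eq]
    refine ⟨single (x, y) 1, ?_⟩
    rw [chainBoundary₂_single]
    abel
  let t : G →* Multiplicative M := MonoidHom.mk' (fun g => Multiplicative.ofAdd
    (Submodule.Quotient.mk (single g 1))) fun x y => by rw [hmk]; rfl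
  have ht : ∀ g, (Submodule.Quotient.mk (single g 1) : M) = 0 := fun g =>
    Abelianization.commutator_subset_ker t (hG ▸ Subgroup.mem_top g)
  have hM : (LinearMap.range (chainBoundary₂ G)).mkQ = 0 := by
    ext g
    exact ht g
  refine not_subsingleton (integralHomology G 1) ⟨fun x y => ?_⟩
  have key : ∀ x : H1 (integralCoefficients G), x = 0 := fun x => by
    induction x using H1_induction_on with
    | h x =>
      rw [H1π_eq_zero_iff]
      exact (Submodule.Quotient.mk_eq_zero _).1 (LinearMap.congr_fun hM x.1)
  exact (key x).trans (key y).symm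

theorem linearCombination_chainBoundary₃ {A : Type*} [AddCommGroup A] {f : G → G → A}
    (hf : IsTwoCocycle f) (c : G × G × G →₀ ULift.{u} ℤ) :
    linearCombination (ULift.{u} ℤ) (fun p : G × G => f p.1 p.2) (chainBoundary₃ G c) = 0 := by
  have : linearCombination (ULift.{u} ℤ) (fun p : G × G => f p.1 p.2) ∘ₗ chainBoundary₃ G = 0 := by
    ext ⟨x, y, z⟩
    simp only [LinearMap.comp_apply, lsingle_apply, LinearMap.zero_apply]
    rw [chainBoundary₃_single]
    simp only [map_add, map_sub, linearCombination_single, one_smul]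
    rw [sub_add_eq_add_sub, ← hf x y z]
    abel
  exact LinearMap.congr_fun this c

/-- On a superperfect group every cocycle is a coboundary. -/
theorem IsTwoCocycle.isTwoCoboundary_of_subsingleton (h1 : Subsingleton (integralHomology G 1))
    (h2 : Subsingleton (integralHomology G 2)) {A : Type*} [AddCommGroup A] {f : G → G → A}
    (hf : IsTwoCocycle f) : IsTwoCoboundary f := by
  -- With `c g` bounding `single g 1`, the chain `(x, y) - c x - c y + c (x * y)` is a cycle, hence
  -- a boundary, and the linear extension of `f` vanishes on it. Thus `g ↦ F (c g)` has coboundary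
  -- `f`.
  choose c hc using fun g : G => exists_chainBoundary₂_eq h1 (single g 1)
  let F := linearCombination (ULift.{u} ℤ) (fun p : G × G => f p.1 p.2)
  refine ⟨fun g => F (c g), fun x y => ?_⟩
  obtain ⟨b, hb⟩ := exists_chainBoundary₃_eq h2 (single (x, y) 1 - c x - c y + c (x * y)) (by
    simp only [map_add, map_sub]
    rw [hc, hc, hc, chainBoundary₂_single]
    abel)
  have h3 := linearCombination_chainBoundary₃ hf b
  rw [hb] at h3
  simp only [map_add, map_sub, linearCombination_single, one_smul] at h3
  rw [← sub_eq_zero, ← h3]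
  simp only [F]
  abel

/-- A superperfect group has no nontrivial perfect central extensions. -/
theorem schurGeneratedBy_empty (h1 : Subsingleton (integralHomology G 1))
    (h2 : Subsingleton (integralHomology G 2)) : SchurGeneratedBy Empty G := by
  intro E _ π hπ hz hE
  refine ⟨Empty.elim, ?_⟩
  rw [Set.range_eq_empty, Subgroup.closure_empty, eq_comm, eq_bot_iff]
  let : CommGroup π.ker :=
    { (inferInstance : Group π.ker) with
      mul_comm := fun a b => Subtype.ext (Subgroup.mem_center_iff.1 (hz b.2) a) }
  choose s hs using hπ
  let f : G → G → Additive π.ker := fun x y =>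
    Additive.ofMul ⟨s x * s y * (s (x * y))⁻¹, by simp [MonoidHom.mem_ker, hs]⟩
  have hf : IsTwoCocycle f := fun x y z => by
    apply Additive.toMul.injective
    apply Subtype.ext
    change s x * s y * (s (x * y))⁻¹ * (s (x * y) * s z * (s (x * y * z))⁻¹) =
      s y * s z * (s (y * z))⁻¹ * (s x * s (y * z) * (s (x * (y * z)))⁻¹)
    have hcen := Subgroup.mem_center_iff.1 (hz (f y z).toMul.2) (s x)
    change s x * (s y * s z * (s (y * z))⁻¹) = (s y * s z * (s (y * z))⁻¹) * s x at hcen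
    have e : s y * s z * (s (y * z))⁻¹ * (s x * s (y * z) * (s (x * (y * z)))⁻¹) =
      (s y * s z * (s (y * z))⁻¹ * s x) * s (y * z) * (s (x * (y * z)))⁻¹ := by group
    rw [e, ← hcen, mul_assoc x y z]
    group
  obtain ⟨ψ, hψ⟩ := hf.isTwoCoboundary_of_subsingleton h1 h2
  let c : G → E := fun x => ((ψ x).toMul : π.ker)
  have hcc : ∀ x g, g * c x = c x * g := fun x => Subgroup.mem_center_iff.1 (hz (ψ x).toMul.2)
  have hck : ∀ x, π (c x) = 1 := fun x => (ψ x).toMul.2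
  have hfc : ∀ x y, s x * s y * (s (x * y))⁻¹ = c x * c y * (c (x * y))⁻¹ := fun x y => by
    have := congrArg (fun a : Additive π.ker => ((a.toMul : π.ker) : E)) (hψ x y)
    rw [sub_eq_add_neg] at this
    exact this
  -- Correcting the section `s` by the cochain that trivialises its factor set gives a homomorphic
  -- section. Its range maps onto `G`, so it is all of the perfect group `E` and the kernel is
  -- trivial.
  let t : G →* E := MonoidHom.mk' (fun x => (c x)⁻¹ * s x) fun x y => by
    have e1 : s (x * y) = (c x * c y * (c (x * y))⁻¹)⁻¹ * (s x * s y) := by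
      rw [← hfc]; group
    have e2 : Commute (c y)⁻¹ ((c x)⁻¹ * s x) := Commute.inv_left (hcc y _).symm
    calc (c (x * y))⁻¹ * s (x * y) = (c y)⁻¹ * ((c x)⁻¹ * s x) * s y := by rw [e1]; group
      _ = (c x)⁻¹ * s x * ((c y)⁻¹ * s y) := by rw [e2.eq, mul_assoc]
  have ht : ∀ x, π (t x) = x := fun x => by simp [t, hck, hs]
  have htop : t.range = ⊤ := Subgroup.eq_top_of_map_eq_top hz hE
    (top_le_iff.1 fun x _ => ⟨t x, ⟨x, rfl⟩, ht x⟩)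
  intro e he
  obtain ⟨x, rfl⟩ := (htop ▸ Subgroup.mem_top e : e ∈ t.range)
  rw [MonoidHom.mem_ker, ht] at he
  rw [he, map_one]; exact one_mem _

/-- A perfect finitely presented group with `H₂ ≠ 0` has a nontrivial cocycle over a field. -/
theorem exists_cocycle_of_nontrivial [Group.IsFinitelyPresented G]
    (h1 : Subsingleton (integralHomology G 1)) (h2 : Nontrivial (integralHomology G 2)) :
    ∃ (K : Type u) (_ : Field K) (f : G → G → K), IsTwoCocycle f ∧ ¬ IsTwoCoboundary f := by
  choose c hc using fun g : G => exists_chainBoundary₂_eq h1 (single g 1)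
  let s := linearCombination (ULift.{u} ℤ) c
  have hs : ∀ x, chainBoundary₂ G (s x) = x := fun x => by
    have : chainBoundary₂ G ∘ₗ s = LinearMap.id := by
      ext1 g
      ext1
      simp only [LinearMap.comp_apply, lsingle_apply, s, linearCombination_single, one_smul]
      exact hc g
    exact LinearMap.congr_fun this x
  -- As `H₁ = 0` and `1`-chains are free, the boundary map has a section `s`. The projection onto
  -- cycles that it defines yields a universal cocycle `f` with values in `H₂`.
  let r : (G × G →₀ ULift.{u} ℤ) →ₗ[ULift.{u} ℤ] cycles₂ (integralCoefficients G) :=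
    LinearMap.codRestrict _ (LinearMap.id - s ∘ₗ chainBoundary₂ G) fun x => by
      change chainBoundary₂ G (x - s (chainBoundary₂ G x)) = 0
      rw [map_sub, hs]; exact sub_self _
  let v : (G × G →₀ ULift.{u} ℤ) →ₗ[ULift.{u} ℤ] integralHomology G 2 :=
    (H2π (integralCoefficients G)).hom ∘ₗ r
  have hv : ∀ x (hx : x ∈ cycles₂ (integralCoefficients G)),
      v x = H2π (integralCoefficients G) ⟨x, hx⟩ := fun x hx => by
    have : r x = ⟨x, hx⟩ := by
      apply Subtype.ext
      change x - s (chainBoundary₂ G x) = x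
      rw [show chainBoundary₂ G x = 0 from hx, map_zero, sub_zero]
    change H2π (integralCoefficients G) (r x) = _
    rw [this]
  let f : G → G → integralHomology G 2 := fun x y => v (single (x, y) 1)
  have hf : IsTwoCocycle f := fun x y z => by
    have h3 : v (chainBoundary₃ G (single (x, y, z) 1)) = 0 := by
      exact (hv _ (d₃₂_apply_mem_cycles₂ (A := integralCoefficients G) (single (x, y, z) 1))).trans
        ((H2π_eq_zero_iff _).2 ⟨_, rfl⟩)
    rw [chainBoundary₃_single] at h3
    simp only [map_add, map_sub] at h3
    rw [eq_comm, ← sub_eq_zero, ← h3]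
    simp only [f]
    abel
  -- If `θ ∘ f` is the coboundary of `ψ`, then `θ ∘ v` factors through the boundary map and vanishes
  -- on cycles, which represent all of `H₂`.
  have huniv : ∀ {A : Type u} [AddCommGroup A] (θ : integralHomology G 2 →+ A),
      IsTwoCoboundary (fun x y => θ (f x y)) → θ = 0 := by
    intro A _ θ ⟨ψ, hψ⟩
    have h3 : θ.comp v.toAddMonoidHom =
        (linearCombination (ULift.{u} ℤ) ψ ∘ₗ chainBoundary₂ G).toAddMonoidHom := by
      refine Finsupp.addHom_ext fun p n => ?_
      rw [show single p n = n.down • single p (1 : ULift.{u} ℤ) by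
        rw [smul_single]; congr 1; ext; simp, map_zsmul, map_zsmul]
      congr 1
      change θ (f p.1 p.2) = linearCombination (ULift.{u} ℤ) ψ
        (chainBoundary₂ G (single (p.1, p.2) 1))
      rw [chainBoundary₂_single, show θ (f p.1 p.2) = _ from hψ p.1 p.2]
      simp only [map_add, map_sub, linearCombination_single, one_smul]
      abel
    ext x
    induction x using H2_induction_on with
    | h x =>
      have h4 : θ (v x.1) = linearCombination (ULift.{u} ℤ) ψ (chainBoundary₂ G x.1) :=
        DFunLike.congr_fun h3 x.1
      rw [hv x.1 x.2, show chainBoundary₂ G x.1 = 0 from x.2, map_zero] at h4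
      exact h4
  classical
  have hfin : Module.Finite (ULift.{u} ℤ) (integralHomology G 2) := by
    obtain ⟨k, r, φ, rel, hφ, hr⟩ := exists_presentedBy G
    obtain ⟨q, hq⟩ := hf.exists_splitting φ
    -- Modulo `N` the splitting is constant on the relators, so the universal cocycle becomes a
    -- coboundary and the quotient by `N` is zero. Hence `H₂` is finitely generated.
    let N := Submodule.span (ULift.{u} ℤ) (Set.range fun b => q (rel b) - q 1)
    have hN : N.mkQ.toAddMonoidHom = 0 := huniv N.mkQ.toAddMonoidHom
      (IsTwoCocycle.isTwoCoboundary_of_splitting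
      (fun x y z => by simp only [← map_add, hf x y z]) hφ hr
      (q := fun x => N.mkQ.toAddMonoidHom (q x)) (fun x y => by simp only [hq, map_add, map_sub])
      fun b => by
        rw [← sub_eq_zero, ← map_sub]
        exact (Submodule.Quotient.mk_eq_zero N).2 (Submodule.subset_span ⟨b, rfl⟩))
    refine ⟨⟨Finset.univ.image fun b => q (rel b) - q 1, ?_⟩⟩
    rw [Finset.coe_image, Finset.coe_univ, Set.image_univ, eq_top_iff]
    intro x _
    exact (Submodule.Quotient.mk_eq_zero N).1 (DFunLike.congr_fun hN x)
  obtain ⟨I, hI, θ, hθ⟩ :=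
    Module.Finite.exists_ne_zero_quotient (ULift.{u} ℤ) (integralHomology G 2)
  refine ⟨ULift.{u} ℤ ⧸ I, Ideal.Quotient.field I, fun x y => θ (f x y), fun x y z => ?_,
    fun h => hθ (LinearMap.toAddMonoidHom_injective (huniv θ.toAddMonoidHom h))⟩
  exact (map_add θ _ _).symm.trans ((congrArg θ (hf x y z)).trans (map_add θ _ _))

end Homology

/-! ### Lower bounds for generators and relators of powers -/

section LowerBounds

variable {G : Type u} [Group G]

/-- A group which is not perfect and is finitely generated has a nontrivial homomorphism to the
additive group of a field. -/
theorem exists_field_hom_of_commutator_ne_top [Group.FG G] (hG : commutator G ≠ ⊤) :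
    ∃ (K : Type) (_ : Field K) (χ : G → K), (∀ x y, χ (x * y) = χ x + χ y) ∧ ∃ g, χ g ≠ 0 := by
  have : Nontrivial (Additive (Abelianization G)) := by
    obtain ⟨g, hg⟩ : ∃ g, g ∉ commutator G := by
      by_contra! h
      exact hG (top_le_iff.1 fun x _ => h x)
    exact ⟨Additive.ofMul (Abelianization.of g), 0, fun h =>
      hg ((QuotientGroup.eq_one_iff g).1 h)⟩
  have h1 : Group.FG (Abelianization G) := Group.fg_of_surjective (QuotientGroup.mk'_surjective _)
  have h2 : AddGroup.FG (Additive (Abelianization G)) := AddGroup.fg_iff_mul_fg.2 h1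
  have : Module.Finite ℤ (Additive (Abelianization G)) := Module.Finite.iff_addGroup_fg.2 h2
  obtain ⟨I, hI, θ, hθ⟩ := Module.Finite.exists_ne_zero_quotient ℤ (Additive (Abelianization G))
  refine ⟨ℤ ⧸ I, Ideal.Quotient.field I, fun g => θ (Additive.ofMul (Abelianization.of g)),
    fun x y => ?_, ?_⟩
  · exact map_add θ (Additive.ofMul (Abelianization.of x)) (Additive.ofMul (Abelianization.of y))
  · by_contra! h
    refine hθ (LinearMap.ext fun x => ?_)
    obtain ⟨g, hg⟩ := QuotientGroup.mk_surjective (Additive.toMul x)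
    have := h g
    rw [show Additive.ofMul (Abelianization.of g) = x from hg] at this
    exact this

/-- A quadratic lower bound for the number of relators of powers of a nonperfect group. -/
theorem PresentedBy.sq_le_of_commutator_ne_top [Group.FG G] (hG : commutator G ≠ ⊤) {a n k r : ℕ}
    (ha : a + a ≤ n) (h : PresentedBy (Fin k) (Fin r) (Fin n → G)) : a * a ≤ r := by
  obtain ⟨K, _, χ, hχ, g, hg⟩ := exists_field_hom_of_commutator_ne_top hG
  let s : Fin a → Fin n := fun i => ⟨i, by omega⟩
  let t : Fin a → Fin n := fun i => ⟨a + i, by omega⟩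
  have hst : ∀ i j, s i ≠ t j := fun i j h => by
    have := congrArg Fin.val h
    simp only [s, t] at this
    omega
  have hs : Function.Injective s := fun i j h => by
    have := congrArg Fin.val h
    exact Fin.ext this
  have ht : Function.Injective t := fun i j h => by
    have := congrArg Fin.val h
    simp only [t] at this
    exact Fin.ext (by omega)
  have hχ1 : χ 1 = 0 := by simpa using hχ 1 1
  have := h.card_le_of_independent (ι := Fin a × Fin a)
    (f := fun p x y => χ (x (s p.1)) * χ (y (t p.2))) (fun p x y z => by
      simp only [Pi.mul_apply, hχ]; ring) (by
    rintro c ⟨ψ, hψ⟩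
    ext ⟨i, j⟩
    -- A coboundary is symmetric on commuting elements. On this pair the combination takes the value
    -- `c (i, j) * χ g ^ 2`, on the swapped pair it is `0`, because the index blocks `s` and `t` are
    -- disjoint.
    have e1 := hψ (Pi.mulSingle (s i) g) (Pi.mulSingle (t j) g)
    have e2 := hψ (Pi.mulSingle (t j) g) (Pi.mulSingle (s i) g)
    have hc : (Pi.mulSingle (s i) g : Fin n → G) * Pi.mulSingle (t j) g =
        Pi.mulSingle (t j) g * Pi.mulSingle (s i) g :=
      (Pi.mulSingle_commute (f := fun _ : Fin n => G) (hst i j) g g).eq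
    rw [hc, add_comm (ψ _), ← e2] at e1
    have hχs : ∀ i i', χ ((Pi.mulSingle (s i) g : Fin n → G) (s i')) = if i' = i then χ g else 0 :=
      fun i i' => by
        split_ifs with h
        · rw [h, Pi.mulSingle_eq_same]
        · rw [Pi.mulSingle_eq_of_ne (hs.ne h), hχ1]
    have hχt : ∀ i i', χ ((Pi.mulSingle (t i) g : Fin n → G) (t i')) = if i' = i then χ g else 0 :=
      fun i i' => by
        split_ifs with h
        · rw [h, Pi.mulSingle_eq_same]
        · rw [Pi.mulSingle_eq_of_ne (ht.ne h), hχ1]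
    have hχst : ∀ i i', χ ((Pi.mulSingle (t i) g : Fin n → G) (s i')) = 0 := fun i i' => by
      rw [Pi.mulSingle_eq_of_ne (hst _ _), hχ1]
    simp only [hχs, hχt, hχst, zero_mul, mul_zero, Finset.sum_const_zero] at e1
    rw [Finset.sum_eq_single (i, j)] at e1
    · simpa [hg] using e1
    · rintro ⟨i', j'⟩ - hne
      by_cases h1 : i' = i
      · have : j' ≠ j := fun h2 => hne (by rw [h1, h2])
        simp [this]
      · simp [h1]
    · simp)
  simpa using this

/-- A linear lower bound for the number of relators of powers of a group with a nontrivial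
cocycle over a field. -/
theorem PresentedBy.le_of_not_isTwoCoboundary {K : Type*} [Field K] {f : G → G → K}
    (hf : IsTwoCocycle f) (hf' : ¬ IsTwoCoboundary f) {n k r : ℕ}
    (h : PresentedBy (Fin k) (Fin r) (Fin n → G)) : n ≤ r := by
  have := h.card_le_of_independent (ι := Fin n)
    (f := fun i x y => f (x i) (y i)) (fun i => hf.comp (Pi.evalMonoidHom (fun _ => G) i)) (by
    rintro c ⟨ψ, hψ⟩
    by_contra hc
    obtain ⟨i, hi⟩ := Function.ne_iff.1 hc
    -- Restricted to the `i`-th factor the combination is `c i * f` plus the constants `c j * f 1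
    -- 1`; the subtracted sum absorbs these.
    refine hf' ⟨fun x => (c i)⁻¹ * (ψ (Pi.mulSingle i x) -
      ∑ j ∈ Finset.univ.erase i, c j * f 1 1), fun x y => ?_⟩
    have e := hψ (Pi.mulSingle i x) (Pi.mulSingle i y)
    simp only at e
    rw [← Finset.add_sum_erase _ _ (Finset.mem_univ i), Finset.sum_congr rfl
      (g := fun j => c j * f 1 1) (fun j hj => by
        rw [Pi.mulSingle_eq_of_ne (Finset.ne_of_mem_erase hj),
          Pi.mulSingle_eq_of_ne (Finset.ne_of_mem_erase hj)]),
      Pi.mulSingle_eq_same, Pi.mulSingle_eq_same, ← Pi.mulSingle_mul] at e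
    have hi' : c i ≠ 0 := hi
    rw [← mul_right_injective₀ hi' |>.eq_iff]
    simp only [mul_add, mul_sub, mul_inv_cancel_left₀ hi']
    rw [← eq_sub_iff_add_eq] at e
    rw [e]; ring)
  simpa using this

/-- Powers of a nonperfect group need at least as many generators as there are factors. -/
theorem GeneratedBy.le_of_commutator_ne_top [Group.FG G] (hG : commutator G ≠ ⊤) {n k : ℕ}
    (h : GeneratedBy (Fin k) (Fin n → G)) : n ≤ k := by
  obtain ⟨K, _, χ, hχ, g, hg⟩ := exists_field_hom_of_commutator_ne_top hG
  obtain ⟨φ, hφ⟩ := h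
  have hχ1 : χ 1 = 0 := by simpa using hχ 1 1
  let T : (Fin n → K) →ₗ[K] (Fin k → K) :=
    { toFun := fun c b => ∑ i, c i * χ (φ (.of b) i)
      map_add' := fun c d => by ext b; simp [add_mul, Finset.sum_add_distrib]
      map_smul' := fun a c => by ext b; simp [mul_assoc, Finset.mul_sum] }
  have hT : Function.Injective T := by
    rw [injective_iff_map_eq_zero]
    intro c hc
    let F : FreeGroup (Fin k) →* Multiplicative K := MonoidHom.mk'
      (fun x => Multiplicative.ofAdd (∑ i, c i * χ (φ x i))) fun x y => by
        simp [hχ, mul_add, Finset.sum_add_distrib]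
    have hF : F = 1 := by
      ext b
      exact congrFun hc b
    ext i
    obtain ⟨x, hx⟩ := hφ (Pi.mulSingle i g)
    have h1 : ∑ j, c j * χ (φ x j) = 0 := DFunLike.congr_fun hF x
    rw [hx, Finset.sum_eq_single i] at h1
    · simpa [hg] using h1
    · intro j _ hj
      rw [Pi.mulSingle_eq_of_ne hj, hχ1, mul_zero]
    · simp
  simpa using LinearMap.finrank_le_finrank_of_injective hT

/-- Powers of a group with a nontrivial finite quotient need logarithmically many generators. -/
theorem GeneratedBy.le_card_pow {Q : Type*} [Group Q] [Finite Q] [Nontrivial Q] (p : G →* Q)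
    (hp : Function.Surjective p) {n k : ℕ} (h : GeneratedBy (Fin k) (Fin n → G)) :
    n ≤ Nat.card Q ^ k := by
  obtain ⟨φ, hφ⟩ := h
  -- If two coordinates gave the same images of the generators in `Q`, they would induce the same
  -- homomorphism to `Q`, which `Pi.mulSingle` refutes.
  let e : Fin n → (Fin k → Q) := fun i b => p (φ (.of b) i)
  have he : Function.Injective e := by
    intro i j hij
    by_contra hne
    have h1 : (p.comp (Pi.evalMonoidHom _ i)).comp φ = (p.comp (Pi.evalMonoidHom _ j)).comp φ := by
      ext b
      exact congrFun hij b
    obtain ⟨q, hq⟩ := exists_ne (1 : Q)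
    obtain ⟨g, rfl⟩ := hp q
    obtain ⟨x, hx⟩ := hφ (Pi.mulSingle i g)
    have h2 := DFunLike.congr_fun h1 x
    simp only [MonoidHom.comp_apply, hx, Pi.evalMonoidHom_apply, Pi.mulSingle_eq_same,
      Pi.mulSingle_eq_of_ne (Ne.symm hne), map_one] at h2
    exact hq h2
  have := Nat.card_le_card_of_injective e he
  rwa [Nat.card_fun, Nat.card_fin, Nat.card_fin] at this

/-- A presentation of a perfect group has at least as many relators as generators. -/
theorem PresentedBy.le_of_commutator_eq_top (hG : commutator G = ⊤) {k r : ℕ}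
    (h : PresentedBy (Fin k) (Fin r) G) : k ≤ r := by
  obtain ⟨φ, rel, hφ, hr⟩ := h
  let ε : Fin k → FreeGroup (Fin k) →* Multiplicative ℚ := fun b =>
    FreeGroup.lift fun b' => Multiplicative.ofAdd (if b' = b then 1 else 0)
  let T : (Fin k → ℚ) →ₗ[ℚ] (Fin r → ℚ) :=
    { toFun := fun c j => ∑ b, c b * (ε b (rel j)).toAdd
      map_add' := fun c d => by ext b; simp [add_mul, Finset.sum_add_distrib]
      map_smul' := fun a c => by ext b; simp [mul_assoc, Finset.mul_sum] }
  have hT : Function.Injective T := by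
    rw [injective_iff_map_eq_zero]
    intro c hc
    let F : FreeGroup (Fin k) →* Multiplicative ℚ := MonoidHom.mk'
      (fun x => Multiplicative.ofAdd (∑ b, c b * (ε b x).toAdd)) fun x y => by
        simp [mul_add, Finset.sum_add_distrib]
    have hker : φ.ker ≤ F.ker := by
      rw [← hr]
      refine Subgroup.normalClosure_le_normal ?_
      rintro _ ⟨j, rfl⟩
      exact congrFun hc j
    -- A combination of exponent sums that vanishes on the relators descends to a homomorphism from
    -- `G` to `ℚ`, which is trivial since `G` is perfect.
    let F' : G →* Multiplicative ℚ := φ.liftOfSurjective hφ ⟨F, hker⟩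
    ext b
    have h1 : F' (φ (.of b)) = F (.of b) := by
      simp only [F']
      exact MonoidHom.liftOfRightInverse_comp_apply φ _
        (Function.rightInverse_surjInv hφ) ⟨F, hker⟩ _
    have h2 : F' (φ (.of b)) = 1 :=
      Abelianization.commutator_subset_ker F' (hG ▸ Subgroup.mem_top _)
    have h3 : ∑ b', c b' * (ε b' (.of b)).toAdd = 0 := h1.symm.trans h2
    simpa [ε] using h3
  simpa using LinearMap.finrank_le_finrank_of_injective hT

end LowerBounds

/-! ### Generating powers of perfect groups -/

section Generation

variable {G : Type u} [Group G]

/-- A subgroup of a power of a perfect group is everything if it separates pairs of coordinates. -/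
theorem Subgroup.eq_top_of_separates (hG : _root_.commutator G = ⊤) {ι : Type*} [Finite ι]
    {H : Subgroup (ι → G)} (h1 : ∀ i g, ∃ h ∈ H, h i = g)
    (h2 : ∀ i j, i ≠ j → ∀ g, ∃ h ∈ H, h i = g ∧ h j = 1) : H = ⊤ := by
  classical
  have := Fintype.ofFinite ι
  have key : ∀ i, ∀ T : Finset ι, i ∉ T → ∀ g, ∃ h ∈ H, h i = g ∧ ∀ j ∈ T, h j = 1 := by
    intro i T
    induction T using Finset.induction_on with
    | empty =>
      intro _ g
      obtain ⟨h, hh, hg⟩ := h1 i g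
      exact ⟨h, hh, hg, by simp⟩
    | insert j T hj ih =>
      intro hi
      simp only [Finset.mem_insert, not_or] at hi
      let S : Subgroup G :=
        { carrier := {g | ∃ h ∈ H, h i = g ∧ ∀ l ∈ insert j T, h l = 1}
          one_mem' := ⟨1, one_mem H, rfl, fun _ _ => rfl⟩
          mul_mem' := by
            rintro _ _ ⟨a, ha, rfl, ha1⟩ ⟨b, hb, rfl, hb1⟩
            exact ⟨a * b, mul_mem ha hb, rfl, fun l hl => by
              rw [Pi.mul_apply, ha1 l hl, hb1 l hl, one_mul]⟩
          inv_mem' := by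
            rintro _ ⟨a, ha, rfl, ha1⟩
            exact ⟨a⁻¹, inv_mem ha, rfl, fun l hl => by
              rw [Pi.inv_apply, ha1 l hl, inv_one]⟩ }
      -- The commutator of an element trivial on `T` with one trivial at `j` is trivial on both;
      -- perfectness makes commutators suffice.
      have hS : _root_.commutator G ≤ S := by
        rw [_root_.commutator_def, Subgroup.commutator_le]
        intro a _ b _
        obtain ⟨x, hx, rfl, hx1⟩ := ih hi.2 a
        obtain ⟨y, hy, rfl, hy1⟩ := h2 i j hi.1 b
        refine ⟨⁅x, y⁆, ?_, rfl, fun l hl => ?_⟩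
        · rw [commutatorElement_def]
          exact mul_mem (mul_mem (mul_mem hx hy) (inv_mem hx)) (inv_mem hy)
        · change ⁅x l, y l⁆ = 1
          rcases Finset.mem_insert.1 hl with rfl | hl
          · rw [hy1, commutatorElement_one_right]
          · rw [hx1 l hl, commutatorElement_one_left]
      exact fun g => hS (hG ▸ Subgroup.mem_top g)
  rw [eq_top_iff]
  intro x _
  refine Subgroup.pi_mem_of_mulSingle_mem x fun i => ?_
  obtain ⟨h, hh, hi, hj⟩ := key i (Finset.univ.erase i) (by simp) (x i)
  convert hh
  ext j
  by_cases hij : j = i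
  · subst hij; rw [Pi.mulSingle_eq_same, hi]
  · rw [Pi.mulSingle_eq_of_ne hij, hj j (by simp [hij])]

/-- The diagonal homomorphism onto the coordinates that satisfy `p`. -/
noncomputable def partialDiagonal {ι : Type*} (p : ι → Prop) (G : Type*) [Group G] :
    G →* (ι → G) :=
  open Classical in
  { toFun := fun g i => if p i then g else 1
    map_one' := by ext; simp
    map_mul' := fun x y => by ext i; by_cases h : p i <;> simp [h] }

theorem partialDiagonal_apply {ι : Type*} {p : ι → Prop} {i : ι} (h : p i) (g : G) :
    partialDiagonal p G g i = g := by simp [partialDiagonal, h]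

theorem partialDiagonal_apply_not {ι : Type*} {p : ι → Prop} {i : ι} (h : ¬ p i) (g : G) :
    partialDiagonal p G g i = 1 := by simp [partialDiagonal, h]

/-- Generators of a group, copied along a homomorphism, generate its range. -/
theorem mem_closure_of_closure_eq_top {H α : Type*} [Group H] {x : α → G}
    (hx : Subgroup.closure (Set.range x) = ⊤) (f : G →* H) {S : Set H}
    (hS : ∀ a, f (x a) ∈ S) (g : G) : f g ∈ Subgroup.closure S := by
  have : Subgroup.closure (Set.range x) ≤ (Subgroup.closure S).comap f := by
    rw [Subgroup.closure_le]
    rintro _ ⟨a, rfl⟩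
    exact Subgroup.subset_closure (hS a)
  exact this (hx ▸ Subgroup.mem_top g)

/-- If the coordinates are coded by `m` bits, then `d * (m + 1)` elements generate the power. -/
theorem GeneratedBy.pi_of_injective (hG : commutator G = ⊤) {α : Type} (h : GeneratedBy α G)
    {ι : Type*} [Finite ι] {m : ℕ} {b : ι → Fin m → Bool} (hb : Function.Injective b) :
    GeneratedBy (α × Option (Fin m)) (ι → G) := by
  obtain ⟨x, hx⟩ := h.exists_closure
  -- `none` stands for the full diagonal, `some t` for the coordinates whose bit `t` is set. A bit
  -- in which `i` and `j` differ separates them, by its diagonal or by the complementary one.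
  let P : Option (Fin m) → ι → Prop := fun o i => o.elim True fun t => b i t = true
  refine .of_closure (fun p => partialDiagonal (P p.2) G (x p.1)) ?_
  have hmem : ∀ o g, partialDiagonal (P o) G g ∈
      Subgroup.closure (Set.range fun p : α × Option (Fin m) =>
        partialDiagonal (P p.2) G (x p.1)) := fun o g =>
    mem_closure_of_closure_eq_top hx _ (fun a => Set.mem_range_self (a, o)) g
  have hnone : ∀ i, P none i := fun i => trivial
  refine Subgroup.eq_top_of_separates hG
    (fun i g => ⟨_, hmem none g, partialDiagonal_apply (hnone i) g⟩) fun i j hij g => ?_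
  obtain ⟨t, ht⟩ := Function.ne_iff.1 (hb.ne hij)
  by_cases hi : b i t = true
  · have hj : ¬ b j t = true := fun hj => ht (hi.trans hj.symm)
    exact ⟨_, hmem (some t) g, partialDiagonal_apply (p := P (some t)) hi g,
      partialDiagonal_apply_not (p := P (some t)) hj g⟩
  · have hj : b j t = true := by
      cases h1 : b i t <;> cases h2 : b j t <;> simp_all
    refine ⟨_, mul_mem (hmem none g) (inv_mem (hmem (some t) g)), ?_, ?_⟩
    · rw [Pi.mul_apply, Pi.inv_apply, partialDiagonal_apply (hnone i),
        partialDiagonal_apply_not (p := P (some t)) hi, inv_one, mul_one]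
    · rw [Pi.mul_apply, Pi.inv_apply, partialDiagonal_apply (hnone j),
        partialDiagonal_apply (p := P (some t)) hj, mul_inv_cancel]

theorem GeneratedBy.pi_of_le_two_pow (hG : commutator G = ⊤) {d : ℕ}
    (h : GeneratedBy (Fin d) G) {n m : ℕ} (hn : n ≤ 2 ^ m) :
    GeneratedBy (Fin (d * (m + 1))) (Fin n → G) := by
  obtain ⟨b⟩ : Nonempty (Fin n ↪ (Fin m → Bool)) :=
    Function.Embedding.nonempty_of_card_le (by simpa using hn)
  have e : Fin (d * (m + 1)) ≃ Fin d × Option (Fin m) :=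
    (Finite.equivFinOfCardEq (by simp)).symm
  exact (h.pi_of_injective hG b.injective).comp_surjective e e.surjective

/-- If `g` has infinite order in all nontrivial quotients of the perfect group `G`, then all powers
of `G` are generated by one element more than `G`. -/
theorem GeneratedBy.pi_of_infinite_order (hG : commutator G = ⊤) {d : ℕ}
    (h : GeneratedBy (Fin d) G) {g : G} (hg : ∀ (N : Subgroup G) [N.Normal], Nontrivial (G ⧸ N) →
      ¬ IsOfFinOrder (QuotientGroup.mk g : G ⧸ N)) (n : ℕ) :
    GeneratedBy (Fin (d + 1)) (Fin n → G) := by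
  obtain ⟨x, hx⟩ := h.exists_closure
  let Δ : G →* (Fin n → G) := Pi.constMonoidHom _ _
  let t : Fin n → G := fun i => g ^ (i : ℕ)
  refine .of_closure (Fin.snoc (α := fun _ => Fin n → G) (fun a => Δ (x a)) t) ?_
  set H := Subgroup.closure (Set.range
    (Fin.snoc (α := fun _ => Fin n → G) (fun a => Δ (x a)) t))
  have hΔ : ∀ a, Δ a ∈ H := mem_closure_of_closure_eq_top hx Δ
    fun a => ⟨Fin.castSucc a, by simp⟩
  have ht : t ∈ H := Subgroup.subset_closure ⟨Fin.last d, by simp⟩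
  refine Subgroup.eq_top_of_separates hG (fun i a => ⟨_, hΔ a, rfl⟩) fun i j hij => ?_
  -- `N` is normal because `H` contains the diagonal. It contains `g ^ (i - j)`, so `g` has finite
  -- order modulo `N`, which forces `N = ⊤`.
  let N : Subgroup G :=
    { carrier := {a | ∃ h ∈ H, h i = a ∧ h j = 1}
      one_mem' := ⟨1, one_mem H, rfl, rfl⟩
      mul_mem' := by
        rintro _ _ ⟨a, ha, rfl, ha1⟩ ⟨b, hb, rfl, hb1⟩
        exact ⟨a * b, mul_mem ha hb, rfl, by rw [Pi.mul_apply, ha1, hb1, one_mul]⟩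
      inv_mem' := by
        rintro _ ⟨a, ha, rfl, ha1⟩
        exact ⟨a⁻¹, inv_mem ha, rfl, by rw [Pi.inv_apply, ha1, inv_one]⟩ }
  have hN : N.Normal := ⟨by
    rintro _ ⟨a, ha, rfl, ha1⟩ c
    exact ⟨Δ c * a * (Δ c)⁻¹, mul_mem (mul_mem (hΔ c) ha) (inv_mem (hΔ c)), rfl, by
      simp [ha1]⟩⟩
  have hmem : g ^ ((i : ℤ) - (j : ℤ)) ∈ N :=
    ⟨t * Δ (g ^ (-(j : ℤ))), mul_mem ht (hΔ _), by
      simp [t, Δ, zpow_sub], by simp [t, Δ]⟩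
  have hne : ((i : ℤ) - (j : ℤ)) ≠ 0 := fun h0 => hij (Fin.ext (by omega))
  have htop : N = ⊤ := by
    by_contra hN'
    have : Nontrivial (G ⧸ N) := QuotientGroup.nontrivial_iff.2 hN'
    refine hg N this (isOfFinOrder_iff_zpow_eq_one.2 ⟨_, hne, ?_⟩)
    rw [← QuotientGroup.mk_zpow, QuotientGroup.eq_one_iff]
    exact hmem
  exact fun a => (htop ▸ Subgroup.mem_top a : a ∈ N)

end Generation

/-! ### Presentations of powers by repeated doubling -/

section Powers

variable {G : Type u} [Group G]

/-- Splitting a power of a group into two blocks of coordinates. -/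
def MulEquiv.finAddArrow (G : Type u) [Group G] (a b : ℕ) :
    (Fin (a + b) → G) ≃* (Fin a → G) × (Fin b → G) where
  toFun f := (fun i => f (Fin.castAdd b i), fun i => f (Fin.natAdd a i))
  invFun p := Fin.append p.1 p.2
  left_inv f := Fin.append_castAdd_natAdd
  right_inv p := by ext <;> simp
  map_mul' _ _ := rfl

theorem commutator_pi_eq_top (hG : commutator G = ⊤) (n : ℕ) : commutator (Fin n → G) = ⊤ := by
  rw [eq_top_iff]
  intro x _
  refine Subgroup.pi_mem_of_mulSingle_mem x fun i => ?_
  have h1 : (commutator G).map (MonoidHom.mulSingle (fun _ : Fin n => G) i) ≤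
      commutator (Fin n → G) := by
    rw [commutator_def, commutator_def, Subgroup.map_commutator]
    exact Subgroup.commutator_mono le_top le_top
  exact h1 ⟨x i, hG ▸ Subgroup.mem_top _, rfl⟩

theorem SchurGeneratedBy.pi_two_pow (hG : commutator G = ⊤) {s : ℕ}
    (h : SchurGeneratedBy (Fin s) G) (m : ℕ) :
    SchurGeneratedBy (Fin (s * 2 ^ m)) (Fin (2 ^ m) → G) := by
  induction m with
  | zero =>
    exact h.congr (finCongr (by simp)) (MulEquiv.funUnique (Fin 1) G).symm
  | succ m ih =>
    have hc := commutator_pi_eq_top hG (2 ^ m)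
    rw [pow_succ 2 m, mul_two]
    exact (ih.prod ih hc hc).congr
      (finSumFinEquiv.trans (finCongr (by ring))) (MulEquiv.finAddArrow G _ _).symm

/-- Presentations of the powers `G ^ (2 ^ m)` of a perfect group, by repeated doubling. -/
theorem PresentedBy.pi_two_pow (hG : commutator G = ⊤) {k r s K M : ℕ}
    (h : PresentedBy (Fin k) (Fin r) G) (hs : SchurGeneratedBy (Fin s) G)
    (hK : ∀ m ≤ M, GeneratedBy (Fin K) (Fin (2 ^ m) → G)) {m : ℕ} (hm : m ≤ M) :
    PresentedBy (Fin K) (Fin (r + K + m * (K * K + 3 * K) + s * 2 ^ (m + 1)))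
      (Fin (2 ^ m) → G) := by
  induction m with
  | zero =>
    have h1 := h.congr (Equiv.refl _) (Equiv.refl _) (MulEquiv.funUnique (Fin 1) G).symm
    refine (h1.change_generators (hK 0 hm)).of_card_le (by simp) ?_
    simp only [Nat.card_sum, Nat.card_fin]
    omega
  | succ m ih =>
    have h1 := ih (by omega)
    have h2 := hs.pi_two_pow hG (m + 1)
    have h3 := hK (m + 1) hm
    rw [pow_succ 2 m, mul_two] at h2 h3 ⊢
    -- Doubling costs `K * K` commutators, `2 * K` relators for perfectness and `s * 2 ^ (m + 1)`
    -- for the central kernel; returning to `K` generators costs `K` more.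
    have h4 := (h1.prod_self (commutator_pi_eq_top hG _)
      (h2.congr (Equiv.refl _) (MulEquiv.finAddArrow G _ _))).congr (Equiv.refl _)
        (Equiv.refl _) (MulEquiv.finAddArrow G _ _).symm
    refine (h4.change_generators h3).of_card_le (by simp) ?_
    simp only [Nat.card_sum, Nat.card_prod, Nat.card_fin]
    apply le_of_eq
    ring

theorem PresentedBy.pi_of_le_two_pow (hG : commutator G = ⊤) {k r s K M n : ℕ}
    (h : PresentedBy (Fin k) (Fin r) G) (hs : SchurGeneratedBy (Fin s) G)
    (hK : ∀ m ≤ M, GeneratedBy (Fin K) (Fin (2 ^ m) → G)) (hn : n ≤ 2 ^ M) :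
    PresentedBy (Fin K) (Fin (r + K + M * (K * K + 3 * K) + s * 2 ^ (M + 1) + K))
      (Fin n → G) := by
  let ι : (Fin n → G) →* (Fin (2 ^ M) → G) :=
    { toFun := fun f i => if h : (i : ℕ) < n then f ⟨i, h⟩ else 1
      map_one' := by ext; simp
      map_mul' := fun f g => by ext i; by_cases h : (i : ℕ) < n <;> simp [h] }
  let π : (Fin (2 ^ M) → G) →* (Fin n → G) :=
    { toFun := fun f i => f (Fin.castLE hn i)
      map_one' := rfl
      map_mul' := fun _ _ => rfl }
  refine ((h.pi_two_pow hG hs hK le_rfl).retract ι π fun f => ?_).of_card_le (by simp) (by simp)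
  ext i
  simp [ι, π]

/-- The obvious presentations of the powers of a group. -/
theorem PresentedBy.pi {k r : ℕ} (h : PresentedBy (Fin k) (Fin r) G) (n : ℕ) :
    PresentedBy (Fin (k * n)) (Fin (r * n + k * k * (n * n))) (Fin n → G) := by
  induction n with
  | zero =>
    refine ⟨1, fun _ => 1, fun x => ⟨1, Subsingleton.elim _ _⟩, ?_⟩
    have : Subsingleton (FreeGroup (Fin (k * 0))) := by rw [mul_zero]; infer_instance
    exact Subsingleton.elim _ _
  | succ n ih =>
    have h1 := h.congr (Equiv.refl _) (Equiv.refl _) (MulEquiv.funUnique (Fin 1) G).symm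
    refine ((ih.prod h1).congr (Equiv.refl _) (Equiv.refl _)
      (MulEquiv.finAddArrow G n 1).symm).of_card_le ?_ ?_
    · simp only [Nat.card_sum, Nat.card_fin]; ring
    · simp only [Nat.card_sum, Nat.card_prod, Nat.card_fin]; nlinarith [Nat.zero_le (k * k * n)]

end Powers

/-! ### Numerical estimates -/

section Bounds

variable {G : Type u} [Group G]

theorem Nat.two_pow_clog_le {n : ℕ} (hn : 2 ≤ n) : 2 ^ Nat.clog 2 n ≤ 2 * n := by
  have h1 := Nat.pow_pred_clog_lt_self (b := 2) one_lt_two (x := n) (by omega)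
  have h2 : 0 < Nat.clog 2 n := Nat.clog_pos one_lt_two hn
  calc 2 ^ Nat.clog 2 n = 2 * 2 ^ (Nat.clog 2 n).pred := by
        rw [← pow_succ', Nat.succ_pred_eq_of_pos h2]
    _ ≤ 2 * n := by omega

/-- From `2 ^ clog ≤ 2 * n` one gets `(clog + 1) * log 2 ≤ 2 * log 2 + log n ≤ 3 * log n`, and `3 /
log 2 < 5`. -/
theorem Nat.clog_add_one_le_log {n : ℕ} (hn : 2 ≤ n) :
    ((Nat.clog 2 n + 1 : ℕ) : ℝ) ≤ 5 * Real.log n := by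
  have h1 : ((2 : ℝ) ^ Nat.clog 2 n) ≤ 2 * n := by exact_mod_cast Nat.two_pow_clog_le hn
  have hn' : (2 : ℝ) ≤ n := by exact_mod_cast hn
  have h2 := Real.log_le_log (by positivity) h1
  rw [Real.log_pow, Real.log_mul (by norm_num) (by positivity)] at h2
  have h3 : Real.log 2 ≤ Real.log n := Real.log_le_log (by norm_num) hn'
  have h4 := Real.log_two_gt_d9
  push_cast
  by_contra! h5
  nlinarith

theorem Real.log_pow_three_le {n : ℕ} : Real.log n ^ 3 ≤ 27 * n := by
  rcases Nat.eq_zero_or_pos n with rfl | hn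
  · simp
  have h0 : (0 : ℝ) ≤ n := by positivity
  have h1 := Real.log_le_rpow_div h0 (ε := 1 / 3) (by norm_num)
  have h2 : 0 ≤ Real.log n := Real.log_natCast_nonneg n
  calc Real.log n ^ 3 ≤ ((n : ℝ) ^ (1 / 3 : ℝ) / (1 / 3)) ^ 3 := pow_le_pow_left₀ h2 h1 3
    _ = 27 * ((n : ℝ) ^ (1 / 3 : ℝ)) ^ 3 := by ring
    _ = 27 * n := by
      rw [← Real.rpow_natCast, ← Real.rpow_mul h0]
      norm_num

/-- Presentations with few generators and relators bound the rank and the number of relators. -/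
theorem bounds_of_presentedBy [Group.FG G] {a b : ℕ → ℝ} {C : ℝ}
    (h : ∀ n : ℕ, 2 ≤ n → ∃ k r : ℕ, PresentedBy (Fin k) (Fin r) (Fin n → G) ∧
      (k : ℝ) ≤ C * a n ∧ (r : ℝ) ≤ C * b n) :
    ((fun n : ℕ => (Group.rank (Fin n → G) : ℝ)) =O[atTop] a) ∧
      ((fun n : ℕ => (minRelators (Fin n → G) : ℝ)) =O[atTop] b) ∧
      ∃ C : ℝ, ∀ n : ℕ, 2 ≤ n → ∃ k r : ℕ, HasPresentation (Fin n → G) k r ∧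
        (k : ℝ) ≤ C * a n ∧ (r : ℝ) ≤ C * b n := by
  refine ⟨.of_bound |C| ?_, .of_bound |C| ?_, C, fun n hn => ?_⟩
  · filter_upwards [eventually_ge_atTop 2] with n hn
    obtain ⟨k, r, hp, hk, -⟩ := h n hn
    have h1 : (Group.rank (Fin n → G) : ℝ) ≤ k := by exact_mod_cast hp.generatedBy.rank_le
    rw [Real.norm_of_nonneg (by positivity), Real.norm_eq_abs, ← abs_mul]
    exact (h1.trans hk).trans (le_abs_self _)
  · filter_upwards [eventually_ge_atTop 2] with n hn
    obtain ⟨k, r, hp, -, hr⟩ := h n hn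
    have h1 : (minRelators (Fin n → G) : ℝ) ≤ r := by exact_mod_cast hp.minRelators_le
    rw [Real.norm_of_nonneg (by positivity), Real.norm_eq_abs, ← abs_mul]
    exact (h1.trans hr).trans (le_abs_self _)
  · obtain ⟨k, r, hp, hk, hr⟩ := h n hn
    obtain ⟨r', hr', hp'⟩ := hp.hasPresentation
    exact ⟨k, r', hp', hk, le_trans (by exact_mod_cast hr') hr⟩

theorem exists_presentedBy_pi [Group.IsFinitelyPresented G] :
    ∃ C : ℝ, ∀ n : ℕ, 2 ≤ n → ∃ k r : ℕ, PresentedBy (Fin k) (Fin r) (Fin n → G) ∧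
      (k : ℝ) ≤ C * n ∧ (r : ℝ) ≤ C * (n : ℝ) ^ 2 := by
  obtain ⟨k, r, h⟩ := exists_presentedBy G
  refine ⟨(k + r + k * k : ℕ), fun n hn => ⟨_, _, h.pi n, ?_, ?_⟩⟩
  · rw [← Nat.cast_mul, Nat.cast_le]
    exact Nat.mul_le_mul_right n (by omega)
  · rw [← Nat.cast_pow, ← Nat.cast_mul, Nat.cast_le]
    have h1 : n ≤ n ^ 2 := Nat.le_self_pow (by norm_num) n
    nlinarith [Nat.mul_le_mul_left r h1, Nat.zero_le (k * n ^ 2)]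

/-- Powers of a perfect group have presentations with logarithmically many generators. -/
theorem exists_presentedBy_pi_of_perfect [Group.IsFinitelyPresented G] (hG : commutator G = ⊤)
    {s : ℕ} (hs : SchurGeneratedBy (Fin s) G) :
    ∃ C : ℝ, 0 ≤ C ∧ ∀ n : ℕ, 2 ≤ n → ∃ k r : ℕ, PresentedBy (Fin k) (Fin r) (Fin n → G) ∧
      (k : ℝ) ≤ C * Real.log n ∧ (r : ℝ) ≤ C * Real.log n ^ 3 + s * (4 * n) := by
  obtain ⟨d, r, h⟩ := exists_presentedBy G
  -- The factor `125 = 5 ^ 3` comes from cubing `M + 1 ≤ 5 * log n`; the term `4 * n` bounds `2 ^ (M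
  -- + 1)`.
  refine ⟨(r + 5 * d + d * d : ℕ) * 125, by positivity, fun n hn => ?_⟩
  set M := Nat.clog 2 n
  set L := Real.log n with hL
  have hM : ((M + 1 : ℕ) : ℝ) ≤ 5 * L := Nat.clog_add_one_le_log hn
  have hK : ∀ m ≤ M, GeneratedBy (Fin (d * (M + 1))) (Fin (2 ^ m) → G) := fun m hm =>
    h.generatedBy.pi_of_le_two_pow hG (Nat.pow_le_pow_right two_pos hm)
  refine ⟨_, _, h.pi_of_le_two_pow hG hs hK (Nat.le_pow_clog one_lt_two n), ?_, ?_⟩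
  · have h1 : (d * (M + 1) : ℕ) ≤ (r + 5 * d + d * d) * (M + 1) :=
      Nat.mul_le_mul_right _ (by nlinarith)
    calc ((d * (M + 1) : ℕ) : ℝ) ≤ ((r + 5 * d + d * d : ℕ) : ℝ) * ((M + 1 : ℕ) : ℝ) := by
          exact_mod_cast h1
      _ ≤ ((r + 5 * d + d * d : ℕ) : ℝ) * (5 * L) := by gcongr
      _ ≤ ((r + 5 * d + d * d : ℕ) : ℝ) * 125 * L := by
        have : 0 ≤ L := Real.log_natCast_nonneg n
        rw [mul_assoc]
        gcongr
        linarith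
  · have h1 : r + d * (M + 1) + M * (d * (M + 1) * (d * (M + 1)) + 3 * (d * (M + 1))) +
        d * (M + 1) ≤ (r + 5 * d + d * d) * (M + 1) ^ 3 := by
      generalize hN : M + 1 = N
      have hMN : M ≤ N := by omega
      have e0 : 1 ≤ N ^ 3 := Nat.one_le_pow _ _ (by omega)
      have e1 : N ≤ N ^ 3 := Nat.le_self_pow (by norm_num) N
      have e2 : N ^ 2 ≤ N ^ 3 := Nat.pow_le_pow_right (by omega) (by norm_num)
      calc _ ≤ r * 1 + d * N + N * (d * N * (d * N) + 3 * (d * N)) + d * N := by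
            rw [mul_one]; gcongr
        _ = r * 1 + 2 * d * N + d * d * N ^ 3 + 3 * d * N ^ 2 := by ring
        _ ≤ r * N ^ 3 + 2 * d * N ^ 3 + d * d * N ^ 3 + 3 * d * N ^ 3 := by gcongr
        _ = (r + 5 * d + d * d) * N ^ 3 := by ring
    have h2 : s * 2 ^ (M + 1) ≤ s * (4 * n) := by
      have : 2 ^ M ≤ 2 * n := Nat.two_pow_clog_le hn
      rw [pow_succ]
      exact Nat.mul_le_mul_left s (by omega)
    have h3 : (((r + 5 * d + d * d) * (M + 1) ^ 3 : ℕ) : ℝ) ≤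
        ((r + 5 * d + d * d : ℕ) : ℝ) * 125 * L ^ 3 := by
      rw [Nat.cast_mul, Nat.cast_pow, mul_assoc]
      gcongr
      calc ((M + 1 : ℕ) : ℝ) ^ 3 ≤ (5 * L) ^ 3 := by gcongr
        _ = 125 * L ^ 3 := by ring
    calc _ ≤ (((r + 5 * d + d * d) * (M + 1) ^ 3 + s * (4 * n) : ℕ) : ℝ) := by
          rw [Nat.cast_le]; omega
      _ ≤ _ := by
        rw [Nat.cast_add]
        push_cast at h3 ⊢
        linarith

/-- Powers of a superperfect group `G` with an element of infinite order in all nontrivial quotients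
have presentations with `rank G + 1` generators and logarithmically many relators. -/
theorem exists_presentedBy_pi_of_infinite_order [Group.IsFinitelyPresented G]
    (hG : commutator G = ⊤) (hs : SchurGeneratedBy (Fin 0) G) {K : ℕ}
    (hK : ∀ n, GeneratedBy (Fin K) (Fin n → G)) :
    ∃ C : ℝ, ∀ n : ℕ, 2 ≤ n → ∃ r : ℕ, PresentedBy (Fin K) (Fin r) (Fin n → G) ∧
      (r : ℝ) ≤ C * Real.log n := by
  obtain ⟨d, r, h⟩ := exists_presentedBy G
  refine ⟨(r + 5 * K + K * K : ℕ) * 5, fun n hn => ?_⟩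
  have hM := Nat.clog_add_one_le_log hn
  refine ⟨_, h.pi_of_le_two_pow hG hs (fun m _ => hK _) (Nat.le_pow_clog one_lt_two n), ?_⟩
  rw [mul_assoc]
  refine le_trans ?_ (mul_le_mul_of_nonneg_left hM (by positivity))
  rw [← Nat.cast_mul, Nat.cast_le]
  nlinarith [Nat.zero_le (Nat.clog 2 n * (r + 2 * K))]

end Bounds

/-! ### The main theorem -/

theorem theorem1p1 {G : Type*} [Group G] [Group.IsFinitelyPresented G] :
    -- (1) `H_1 ≠ 0`
    (Nontrivial (integralHomology G 1) →
      ((fun n : ℕ => (Group.rank (Fin n → G) : ℝ)) =Θ[atTop] fun n : ℕ => (n : ℝ)) ∧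
      ((fun n : ℕ => (minRelators (Fin n → G) : ℝ)) =Θ[atTop] fun n : ℕ => (n : ℝ) ^ 2) ∧
      ∃ C : ℝ, ∀ n : ℕ, 2 ≤ n → ∃ k r : ℕ, HasPresentation (Fin n → G) k r ∧
        (k : ℝ) ≤ C * n ∧ (r : ℝ) ≤ C * (n : ℝ) ^ 2) ∧
    -- (2) `H_1 = 0` and `H_2 ≠ 0`
    (Subsingleton (integralHomology G 1) → Nontrivial (integralHomology G 2) →
      ((fun n : ℕ => (Group.rank (Fin n → G) : ℝ)) =O[atTop] fun n : ℕ => Real.log n) ∧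
      ((fun n : ℕ => (minRelators (Fin n → G) : ℝ)) =Θ[atTop] fun n : ℕ => (n : ℝ)) ∧
      ∃ C : ℝ, ∀ n : ℕ, 2 ≤ n → ∃ k r : ℕ, HasPresentation (Fin n → G) k r ∧
        (k : ℝ) ≤ C * Real.log n ∧ (r : ℝ) ≤ C * n) ∧
    -- (3) `H_1 = H_2 = 0`
    (Subsingleton (integralHomology G 1) → Subsingleton (integralHomology G 2) →
      ((fun n : ℕ => (Group.rank (Fin n → G) : ℝ)) =O[atTop] fun n : ℕ => Real.log n) ∧
      ((fun n : ℕ => (minRelators (Fin n → G) : ℝ)) =O[atTop] fun n : ℕ => Real.log n ^ 3) ∧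
      ∃ C : ℝ, ∀ n : ℕ, 2 ≤ n → ∃ k r : ℕ, HasPresentation (Fin n → G) k r ∧
        (k : ℝ) ≤ C * Real.log n ∧ (r : ℝ) ≤ C * Real.log n ^ 3) ∧
    -- (4) `H_1 = H_2 = 0` and there is a non-trivial finite quotient
    (Subsingleton (integralHomology G 1) → Subsingleton (integralHomology G 2) →
      (∃ N : Subgroup G, N.Normal ∧ Nontrivial (G ⧸ N) ∧ Finite (G ⧸ N)) →
      ((fun n : ℕ => (Group.rank (Fin n → G) : ℝ)) =Θ[atTop] fun n : ℕ => Real.log n) ∧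
      (∃ c₀ c₁ : ℝ, 0 < c₀ ∧ 0 < c₁ ∧ ∀ n : ℕ, 2 ≤ n →
        c₀ * Real.log n ≤ minRelators (Fin n → G) ∧
        (minRelators (Fin n → G) : ℝ) ≤ c₁ * Real.log n ^ 3) ∧
      ∃ C : ℝ, ∀ n : ℕ, 2 ≤ n → ∃ k r : ℕ, HasPresentation (Fin n → G) k r ∧
        (k : ℝ) ≤ C * Real.log n ∧ (r : ℝ) ≤ C * Real.log n ^ 3) ∧
    -- (5) `H_1 = H_2 = 0` and some element has infinite order in every non-trivial quotient
    (Subsingleton (integralHomology G 1) → Subsingleton (integralHomology G 2) →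
      (∃ g : G, ∀ (N : Subgroup G) [N.Normal], Nontrivial (G ⧸ N) →
        ¬ IsOfFinOrder (QuotientGroup.mk g : G ⧸ N)) →
      (∀ n : ℕ, Group.rank (Fin n → G) ≤ Group.rank G + 1) ∧
      ((fun n : ℕ => (minRelators (Fin n → G) : ℝ)) =O[atTop] fun n : ℕ => Real.log n) ∧
      ∃ C : ℝ, ∀ n : ℕ, 2 ≤ n → ∃ k r : ℕ, HasPresentation (Fin n → G) k r ∧
        k ≤ Group.rank G + 1 ∧ (r : ℝ) ≤ C * Real.log n) := by
  have hsuper : Subsingleton (integralHomology G 1) → Subsingleton (integralHomology G 2) →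
      ∃ C : ℝ, ∀ n : ℕ, 2 ≤ n → ∃ k r : ℕ, PresentedBy (Fin k) (Fin r) (Fin n → G) ∧
        (k : ℝ) ≤ C * Real.log n ∧ (r : ℝ) ≤ C * Real.log n ^ 3 := fun h1 h2 => by
    obtain ⟨C, -, hC⟩ := exists_presentedBy_pi_of_perfect (commutator_eq_top_of_subsingleton h1)
      ((schurGeneratedBy_empty h1 h2).congr (Equiv.equivOfIsEmpty Empty (Fin 0)) (MulEquiv.refl G))
    exact ⟨C, by simpa using hC⟩
  refine ⟨fun h1 => ?_, fun h1 h2 => ?_, fun h1 h2 => ?_, fun h1 h2 hN => ?_, fun h1 h2 hg => ?_⟩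
  · have hG := commutator_ne_top_of_nontrivial h1
    obtain ⟨C, hC⟩ := exists_presentedBy_pi (G := G)
    obtain ⟨b1, b2, b3⟩ := bounds_of_presentedBy hC
    refine ⟨⟨b1, .of_bound 1 (.of_forall fun n => ?_)⟩, ⟨b2, .of_bound 9 ?_⟩, b3⟩
    · rw [Real.norm_of_nonneg (by positivity), Real.norm_of_nonneg (by positivity), one_mul,
        Nat.cast_le]
      exact (generatedBy_rank (Fin n → G)).le_of_commutator_ne_top hG
    · filter_upwards [eventually_ge_atTop 2] with n hn
      obtain ⟨k, r, hp, -⟩ := hC n hn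
      have h2 : n / 2 * (n / 2) ≤ minRelators (Fin n → G) :=
        hp.le_minRelators fun k' r' h' => h'.sq_le_of_commutator_ne_top hG (by omega)
      rw [Real.norm_of_nonneg (by positivity), Real.norm_of_nonneg (by positivity)]
      -- Valid since `n ≥ 2`; squaring it gives the constant `9`.
      have h3 : n ≤ 3 * (n / 2) := by omega
      have h4 : n ^ 2 ≤ 9 * minRelators (Fin n → G) := by nlinarith
      exact_mod_cast h4
  · have hG := commutator_eq_top_of_subsingleton h1
    obtain ⟨d, s, h⟩ := exists_presentedBy G
    -- The relator count `s` of any presentation of `G` bounds the generators of the central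
    -- kernels, which contribute the linear term.
    obtain ⟨C, hC0, hC⟩ := exists_presentedBy_pi_of_perfect hG h.schurGeneratedBy
    have hC' : ∀ n : ℕ, 2 ≤ n → ∃ k r : ℕ, PresentedBy (Fin k) (Fin r) (Fin n → G) ∧
        (k : ℝ) ≤ (27 * C + 4 * s) * Real.log n ∧ (r : ℝ) ≤ (27 * C + 4 * s) * n := fun n hn => by
      obtain ⟨k, r, hp, hk, hr⟩ := hC n hn
      refine ⟨k, r, hp, hk.trans ?_, hr.trans ?_⟩
      · have h0 := Real.log_natCast_nonneg n
        have : (0 : ℝ) ≤ s := by positivity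
        gcongr
        linarith
      · have := mul_le_mul_of_nonneg_left (Real.log_pow_three_le (n := n)) hC0
        linarith
    obtain ⟨b1, b2, b3⟩ := bounds_of_presentedBy hC'
    refine ⟨b1, ⟨b2, .of_bound 1 ?_⟩, b3⟩
    obtain ⟨K, _, f, hf, hf'⟩ := exists_cocycle_of_nontrivial h1 h2
    filter_upwards [eventually_ge_atTop 2] with n hn
    obtain ⟨k, r, hp, -⟩ := hC n hn
    rw [Real.norm_of_nonneg (by positivity), Real.norm_of_nonneg (by positivity), one_mul,
      Nat.cast_le]
    exact hp.le_minRelators fun k' r' h' => h'.le_of_not_isTwoCoboundary hf hf'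
  · obtain ⟨C, hC⟩ := hsuper h1 h2
    exact bounds_of_presentedBy hC
  · have hG := commutator_eq_top_of_subsingleton h1
    obtain ⟨C, hC⟩ := hsuper h1 h2
    obtain ⟨b1, b2, b3⟩ := bounds_of_presentedBy hC
    obtain ⟨N, hN, hN1, hN2⟩ := hN
    have hq : 1 < Nat.card (G ⧸ N) := Finite.one_lt_card
    have hlq : 0 < Real.log (Nat.card (G ⧸ N)) := Real.log_pos (by exact_mod_cast hq)
    have hrank : ∀ n : ℕ, Real.log n ≤
        Real.log (Nat.card (G ⧸ N)) * Group.rank (Fin n → G) := fun n => by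
      rcases Nat.eq_zero_or_pos n with rfl | hn
      · simp only [Nat.cast_zero, Real.log_zero]; positivity
      have h3 := (generatedBy_rank (Fin n → G)).le_card_pow (QuotientGroup.mk' N)
        (QuotientGroup.mk'_surjective N)
      have h4 : (n : ℝ) ≤ (Nat.card (G ⧸ N) : ℝ) ^ Group.rank (Fin n → G) := by exact_mod_cast h3
      have h5 := Real.log_le_log (by positivity) h4
      rw [Real.log_pow] at h5
      linarith
    refine ⟨⟨b1, .of_bound (Real.log (Nat.card (G ⧸ N))) (.of_forall fun n => ?_)⟩,
      ⟨(Real.log (Nat.card (G ⧸ N)))⁻¹, |C| + 1, by positivity, by positivity, fun n hn => ?_⟩, b3⟩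
    · rw [Real.norm_of_nonneg (Real.log_natCast_nonneg n), Real.norm_of_nonneg (by positivity)]
      exact hrank n
    · obtain ⟨k, r, hp, -, hr⟩ := hC n hn
      constructor
      · have h3 : Group.rank (Fin n → G) ≤ minRelators (Fin n → G) :=
          hp.le_minRelators fun k' r' h' => h'.generatedBy.rank_le.trans
            (h'.le_of_commutator_eq_top (commutator_pi_eq_top hG n))
        rw [inv_mul_le_iff₀ hlq]
        refine (hrank n).trans ?_
        gcongr
      · have h3 : (minRelators (Fin n → G) : ℝ) ≤ r := by exact_mod_cast hp.minRelators_le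
        have h4 : 0 ≤ Real.log n ^ 3 := pow_nonneg (Real.log_natCast_nonneg n) 3
        refine (h3.trans hr).trans (mul_le_mul_of_nonneg_right ?_ h4)
        linarith [le_abs_self C]
  · have hG := commutator_eq_top_of_subsingleton h1
    obtain ⟨g, hg⟩ := hg
    have hK := fun n => (generatedBy_rank G).pi_of_infinite_order hG hg n
    obtain ⟨C, hC⟩ := exists_presentedBy_pi_of_infinite_order hG
      ((schurGeneratedBy_empty h1 h2).congr (Equiv.equivOfIsEmpty Empty (Fin 0)) (MulEquiv.refl G))
      hK
    refine ⟨fun n => (hK n).rank_le, .of_bound |C| ?_, C, fun n hn => ?_⟩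
    · filter_upwards [eventually_ge_atTop 2] with n hn
      obtain ⟨r, hp, hr⟩ := hC n hn
      have h1 : (minRelators (Fin n → G) : ℝ) ≤ r := by exact_mod_cast hp.minRelators_le
      rw [Real.norm_of_nonneg (by positivity), Real.norm_eq_abs, ← abs_mul]
      exact (h1.trans hr).trans (le_abs_self _)
    · obtain ⟨r, hp, hr⟩ := hC n hn
      obtain ⟨r', hr', hp'⟩ := hp.hasPresentation
      exact ⟨_, r', hp', le_rfl, le_trans (by exact_mod_cast hr') hr⟩
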